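/- **Setting.** Let $n\ge 1$, let $\Omega\subset\mathbb R^n$ be a bounded domain (open, connected, non-empty) satisfying the uniform exterior ball condition: there are $r_\Omega>0$ and, for each $x\in\partial\Omega$ and $0<r\le r_\Omega$, a (fixed) point $y_x^r\in\Omega^c$ with $\bar B_r(y_x^r)\cap\bar\Omega=\{x\}$. Let $0<\sigma<2$, $\Lambda>0$, let $\mathcal A,\mathcal B$ be non-empty index sets, and let $K_{ab}(x,z)$, $b_{ab}(x)\in\mathbb R^n$, $c_{ab}(x)\in\mathbb R$, $f_{ab}(x)\in\mathbb R$ ($a\in\mathcal A$, $b\in\mathcal B$, $x,z\in\mathbb R^n$) be given. Put $$I_{ab}[x,u]=\int_{\mathbb R^n}\delta_zu(x)K_{ab}(x,z)\,dz,\qquad \delta_zu(x)=\begin{cases}u(x+z)-u(x),&\sigma<1,\\ u(x+z)-u(x)-\mathbf 1_{B_1}(z)\nabla u(x)\cdot z,&\sigma=1,\\ u(x+z)-u(x)-\nabla u(x)\cdot z,&\sigma>1,\end{cases}$$ and consider the Dirichlet problem $$(\ast)\qquad \sup_{a\in\mathcal A}\inf_{b\in\mathcal B}\{-I_{ab}[x,u]+b_{ab}(x)\cdot\nabla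 u(x)+c_{ab}(x)u(x)+f_{ab}(x)\}=0\ \text{ in }\Omega,\qquad u=g\ \text{ in }\Omega^c .$$ A bounded upper (lower) semicontinuous $u:\mathbb R^n\to\mathbb R$ is a viscosity subsolution (supersolution) of $(\ast)$ if $u\le g$ ($u\ge g$) in $\Omega^c$ and, whenever $\varphi\in C^2(\mathbb R^n)$ is bounded and $u-\varphi$ has a maximum (minimum) over $\mathbb R^n$ at some $x\in\Omega$, $$\sup_{a}\inf_{b}\{-I_{ab}[x,\varphi]+b_{ab}(x)\cdot\nabla\varphi(x)+c_{ab}(x)u(x)+f_{ab}(x)\}\le 0\quad(\ge 0).$$ **Theorem 5.11.** Assume: 1. $b_{ab}\equiv0$ in $\Omega$ if $\sigma<1$, and there is $\gamma>0$ with $c_{ab}\ge\gamma$ in $\Omega$ for all $a,b$. 2. The families $\{b_{ab}\}_{a,b}$, $\{c_{ab}\}_{a,b}$, $\{f_{ab}\}_{a,b}$ and, for every $z\neq0$, $\{K_{ab}(\cdot,z)\}_{a,b}$ are bounded and continuous in $\Omega$, uniformly in $a\in\mathcal A$, $b\in\mathcal B$ (that is, uniformly bounded on $\Omega$ and equicontinuous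 at each point of $\Omega$). 3. For all $a,b$ and $x\in\Omega$ the kernel $K=K_{ab}(x,\cdot)$ is Lebesgue measurable and satisfies: (H0) $K\ge0$; (H1) $\int_{B_{2\delta}\setminus B_\delta}K(z)\,dz\le(2-\sigma)\Lambda\delta^{-\sigma}$ for all $\delta>0$; (H2) $\left|\int_{B_{2\delta}\setminus B_\delta}zK(z)\,dz\right|\le\Lambda|1-\sigma|\delta^{1-\sigma}$ for all $\delta>0$. 4. ($\overline{\mathrm{H3}}$) There are $C_4>0$, $0<r_1<r_\Omega$, $\lambda>0$, $\mu>0$ such that for all $x\in\partial\Omega$, $0<r<r_1$, $y\in\Omega\cap B_{2r}(y_x^r)$ and all $a,b$, writing $d=|y-y_x^r|-r$ and $\nu=(y-y_x^r)/|y-y_x^r|$, there is a measurable set $A$ with $$A\subset\{z:\ z\cdot\nu<-d\}\cap(B_{C_4d}\setminus B_d),\qquad |A|\ge\mu|B_d|,\qquad K_{ab}(y,z)\ge(2-\sigma)\lambda d^{-n-\sigma}\ \text{ for } z\in A.$$ 5. $g:\mathbb R^n\to\mathbb R$ is bounded and continuous. Then $(\ast)$ admits a continuous viscosity supersolution $\bar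 u$ and a continuous viscosity subsolution $\underline u$, and $\bar u=\underline u=g$ in $\Omega^c$. -/

import Mathlib

open MeasureTheory

noncomputable section

/-- The increment `δ_z u (x)` of a Lévy operator of order `σ`; `fderiv ℝ u x z` is `∇u(x) · z`. -/
def levyIncrement {n : ℕ} (σ : ℝ) (u : EuclideanSpace ℝ (Fin n) → ℝ)
    (x z : EuclideanSpace ℝ (Fin n)) : ℝ :=
  if σ < 1 then u (x + z) - u x
  else if σ = 1 then
    u (x + z) - u x - (Metric.ball 0 1).indicator (fun w => fderiv ℝ u x w) z
  else u (x + z) - u x - fderiv ℝ u x z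

/-- `∫ δ_z u (x) k(z) dz`, the Lévy operator with kernel `k`, evaluated at `x`. -/
def levyOp {n : ℕ} (σ : ℝ) (k : EuclideanSpace ℝ (Fin n) → ℝ)
    (u : EuclideanSpace ℝ (Fin n) → ℝ) (x : EuclideanSpace ℝ (Fin n)) : ℝ :=
  ∫ z, levyIncrement σ u x z * k z

/-- The half-open annulus `B_{2δ} \ B_δ` centred at the origin. -/
def dyadicShell (n : ℕ) (δ : ℝ) : Set (EuclideanSpace ℝ (Fin n)) :=
  Metric.ball 0 (2 * δ) \ Metric.ball 0 δ

/-- The standing assumptions on a single kernel of order `σ`: nonnegativity, the bound on the mass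
of each annulus, and the bound on the first moment of each annulus. -/
structure IsLevyKernel {n : ℕ} (σ Λ : ℝ) (k : EuclideanSpace ℝ (Fin n) → ℝ) : Prop where
  nonneg : ∀ z, 0 ≤ k z
  integrableOn : ∀ δ : ℝ, 0 < δ → IntegrableOn k (dyadicShell n δ)
  mass_le : ∀ δ : ℝ, 0 < δ → ∫ z in dyadicShell n δ, k z ≤ (2 - σ) * Λ * δ ^ (-σ)
  moment_le : ∀ δ : ℝ, 0 < δ →
    ‖∫ z in dyadicShell n δ, k z • z‖ ≤ Λ * |1 - σ| * δ ^ (1 - σ)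

/-- `Ω` satisfies the uniform exterior ball condition with radius `rΩ`, and `c x r` is the centre
of an exterior ball of radius `r` that touches `closure Ω` exactly at `x`. -/
structure IsExteriorBallFamily {n : ℕ} (Ω : Set (EuclideanSpace ℝ (Fin n))) (rΩ : ℝ)
    (c : EuclideanSpace ℝ (Fin n) → ℝ → EuclideanSpace ℝ (Fin n)) : Prop where
  radius_pos : 0 < rΩ
  center_mem : ∀ x ∈ frontier Ω, ∀ r : ℝ, 0 < r → r ≤ rΩ → c x r ∈ Ωᶜ
  touches : ∀ x ∈ frontier Ω, ∀ r : ℝ, 0 < r → r ≤ rΩ →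
    Metric.closedBall (c x r) r ∩ closure Ω = {x}

/-- One-kernel non-degeneracy at a point `y` seen from an exterior ball of radius `r` centred at
`p`. Here `‖y - p‖ - r` is the distance from `y` to that ball (`r s_y^r` for
`s_y^r = ‖y - p‖ / r - 1`), and `‖y - p‖⁻¹ • (y - p)` is the unit vector from `p` towards `y`. -/
def NondegenerateTowards {n : ℕ} (σ C lam μ : ℝ) (k : EuclideanSpace ℝ (Fin n) → ℝ)
    (p : EuclideanSpace ℝ (Fin n)) (r : ℝ) (y : EuclideanSpace ℝ (Fin n)) : Prop :=
  ∃ A : Set (EuclideanSpace ℝ (Fin n)), MeasurableSet A ∧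
    A ⊆ {z | inner ℝ z (‖y - p‖⁻¹ • (y - p)) < -(‖y - p‖ - r)} ∩
      (Metric.ball 0 (C * (‖y - p‖ - r)) \ Metric.ball 0 (‖y - p‖ - r)) ∧
    ENNReal.ofReal μ * volume (Metric.ball (0 : EuclideanSpace ℝ (Fin n)) (‖y - p‖ - r))
      ≤ volume A ∧
    ∀ z ∈ A, (2 - σ) * lam * (‖y - p‖ - r) ^ (-(n : ℝ) - σ) ≤ k z

/-- Boundary non-degeneracy of a family of kernels `K a b x` (`x ∈ Ω`) with respect to the exterior
balls with centres `c x r`; the constants do not depend on the point or on the indices. -/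
def BoundaryNondegenerate {n : ℕ} {𝒜 ℬ : Type*} (σ : ℝ) (Ω : Set (EuclideanSpace ℝ (Fin n)))
    (rΩ : ℝ) (c : EuclideanSpace ℝ (Fin n) → ℝ → EuclideanSpace ℝ (Fin n))
    (K : 𝒜 → ℬ → EuclideanSpace ℝ (Fin n) → EuclideanSpace ℝ (Fin n) → ℝ) : Prop :=
  ∃ C r₁ lam μ : ℝ, 0 < C ∧ 0 < r₁ ∧ r₁ < rΩ ∧ 0 < lam ∧ 0 < μ ∧
    ∀ x ∈ frontier Ω, ∀ r : ℝ, 0 < r → r < r₁ →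
      ∀ y ∈ Ω ∩ Metric.ball (c x r) (2 * r), ∀ (a : 𝒜) (b : ℬ),
        NondegenerateTowards σ C lam μ (K a b y) (c x r) r y

/-- A family of maps on `Ω` that is uniformly bounded on `Ω` and continuous on `Ω`, uniformly in
the two indices. -/
def UniformlyBoundedContinuousOn {n : ℕ} {𝒜 ℬ F : Type*} [NormedAddCommGroup F]
    (h : 𝒜 → ℬ → EuclideanSpace ℝ (Fin n) → F) (Ω : Set (EuclideanSpace ℝ (Fin n))) : Prop :=
  (∃ M : ℝ, ∀ (a : 𝒜) (b : ℬ), ∀ x ∈ Ω, ‖h a b x‖ ≤ M) ∧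
    EquicontinuousOn (fun (i : 𝒜 × ℬ) x => h i.1 i.2 x) Ω

/-- The data of a nonlocal Bellman–Isaacs operator: kernels, drifts, zeroth-order coefficients and
source terms, indexed by `𝒜` and `ℬ`. -/
structure IsaacsData (n : ℕ) (𝒜 ℬ : Type*) where
  /-- the kernels `K_ab(x, z)` -/
  K : 𝒜 → ℬ → EuclideanSpace ℝ (Fin n) → EuclideanSpace ℝ (Fin n) → ℝ
  /-- the drifts `b_ab(x)` -/
  drift : 𝒜 → ℬ → EuclideanSpace ℝ (Fin n) → EuclideanSpace ℝ (Fin n)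
  /-- the zeroth-order coefficients `c_ab(x)` -/
  c : 𝒜 → ℬ → EuclideanSpace ℝ (Fin n) → ℝ
  /-- the source terms `f_ab(x)` -/
  f : 𝒜 → ℬ → EuclideanSpace ℝ (Fin n) → ℝ

/-- `sup_a inf_b { -I_ab[x, φ] + b_ab(x) · ∇φ(x) + c_ab(x) t + f_ab(x) }`, with supremum and
infimum taken in the extended reals. -/
def IsaacsData.op {n : ℕ} {𝒜 ℬ : Type*} (D : IsaacsData n 𝒜 ℬ) (σ : ℝ)
    (x : EuclideanSpace ℝ (Fin n)) (t : ℝ) (φ : EuclideanSpace ℝ (Fin n) → ℝ) : EReal :=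
  ⨆ a : 𝒜, ⨅ b : ℬ,
    ((-levyOp σ (D.K a b x) φ x + fderiv ℝ φ x (D.drift a b x) + D.c a b x * t + D.f a b x : ℝ) :
      EReal)

/-- The test functions: bounded functions of class `C²` on the whole space. -/
def IsTestFunction {n : ℕ} (φ : EuclideanSpace ℝ (Fin n) → ℝ) : Prop :=
  ContDiff ℝ 2 φ ∧ ∃ M : ℝ, ∀ x, |φ x| ≤ M

/-- Viscosity subsolutions of the Bellman–Isaacs equation in `Ω`. -/
structure IsViscositySubsolution {n : ℕ} {𝒜 ℬ : Type*} (D : IsaacsData n 𝒜 ℬ) (σ : ℝ)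
    (Ω : Set (EuclideanSpace ℝ (Fin n))) (u : EuclideanSpace ℝ (Fin n) → ℝ) : Prop where
  bounded : ∃ M : ℝ, ∀ x, |u x| ≤ M
  usc : UpperSemicontinuous u
  le_zero : ∀ φ, IsTestFunction φ → ∀ x ∈ Ω, (∀ y, u y - φ y ≤ u x - φ x) →
    D.op σ x (u x) φ ≤ 0

/-- Viscosity supersolutions of the Bellman–Isaacs equation in `Ω`. -/
structure IsViscositySupersolution {n : ℕ} {𝒜 ℬ : Type*} (D : IsaacsData n 𝒜 ℬ) (σ : ℝ)
    (Ω : Set (EuclideanSpace ℝ (Fin n))) (u : EuclideanSpace ℝ (Fin n) → ℝ) : Prop where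
  bounded : ∃ M : ℝ, ∀ x, |u x| ≤ M
  lsc : LowerSemicontinuous u
  zero_le : ∀ φ, IsTestFunction φ → ∀ x ∈ Ω, (∀ y, u x - φ x ≤ u y - φ y) →
    0 ≤ D.op σ x (u x) φ

/-- Viscosity subsolutions of the Dirichlet problem with exterior datum `g`. -/
def IsDirichletSubsolution {n : ℕ} {𝒜 ℬ : Type*} (D : IsaacsData n 𝒜 ℬ) (σ : ℝ)
    (Ω : Set (EuclideanSpace ℝ (Fin n))) (g u : EuclideanSpace ℝ (Fin n) → ℝ) : Prop :=
  IsViscositySubsolution D σ Ω u ∧ ∀ x ∈ Ωᶜ, u x ≤ g x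

/-- Viscosity supersolutions of the Dirichlet problem with exterior datum `g`. -/
def IsDirichletSupersolution {n : ℕ} {𝒜 ℬ : Type*} (D : IsaacsData n 𝒜 ℬ) (σ : ℝ)
    (Ω : Set (EuclideanSpace ℝ (Fin n))) (g u : EuclideanSpace ℝ (Fin n) → ℝ) : Prop :=
  IsViscositySupersolution D σ Ω u ∧ ∀ x ∈ Ωᶜ, g x ≤ u x

end

noncomputable section

/-! The barrier is `A * dist(·, ball)^α` for a small exterior ball and a small exponent `α`. At
distance `d` from the ball, short jumps, the compensator and the growth along long jumps contribute
to the Lévy operator at most a multiple of `A * α * d ^ (α - σ)`. By the boundary non-degeneracy,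
jumps landing almost in the ball have mass at least `c₀ * d ^ (-σ)`, and each lowers the barrier by
at least half of `A * d ^ α`. This gain carries no factor `α`, so it wins once `α` is small. The
drift is absorbed in the same way, because `d ^ (α - 1) ≤ d ^ (α - σ)` for `σ ≥ 1` and `d ≤ 1`. The
estimate is proved directly for test functions touching the barrier from below
(`exists_levyOp_le_of_touching_ballBarrier`, `exists_strict_barrier_parameters`).

The supersolution is an envelope (`exists_barrier_envelope`): the infimum of a constant `M` and of
the functions `g x + δ + A * barrier`, over boundary points `x` and a sequence `δ → 0`, with radii
tending to zero and `A` depending on `δ`. Each member lies above `g` everywhere and above `M`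
outside a thin collar of its ball. Hence the infimum is locally finite in `Ω`, tends to `g` at the
boundary, and is touched from above at each point of `Ω` by `M` or by a barrier inside its collar.
In the first case `c ≥ γ` and a large `M` suffice; in the second a large `A` dominates the
zeroth-order and source terms.

The inequality holds for every pair of indices separately (`exists_common_supersolution`), so it
survives the sup-inf, and the same construction for `-g` and `-f` gives the subsolution by
reflection. -/

theorem integrableOn_iUnion_and_integral_le_of_geometric {X : Type*} [MeasurableSpace X]
    {μ : Measure X} {s : ℕ → Set X} {f : X → ℝ} (hs : ∀ i, MeasurableSet (s i))
    (hd : Pairwise (Function.onFun Disjoint s)) (hf : ∀ z, 0 ≤ f z)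
    (hi : ∀ i, IntegrableOn f (s i) μ) {B q : ℝ} (hq0 : 0 ≤ q) (hq1 : q < 1)
    (hB : ∀ i, ∫ z in s i, f z ∂μ ≤ B * q ^ i) :
    IntegrableOn f (⋃ i, s i) μ ∧ ∫ z in ⋃ i, s i, f z ∂μ ≤ B / (1 - q) := by
  have hg : HasSum (fun i : ℕ => B * q ^ i) (B * (1 - q)⁻¹) :=
    (hasSum_geometric_of_lt_one hq0 hq1).mul_left B
  have hsum : Summable fun i => ∫ z in s i, ‖f z‖ ∂μ := by
    simp only [Real.norm_of_nonneg (hf _)]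
    exact Summable.of_nonneg_of_le (fun i => integral_nonneg hf) hB hg.summable
  have hint : IntegrableOn f (⋃ i, s i) μ :=
    integrableOn_iUnion_of_summable_integral_norm hi hsum
  refine ⟨hint, ?_⟩
  rw [div_eq_mul_inv]
  exact hasSum_le hB (hasSum_integral_iUnion hs hd hint) hg

/-! ### Dyadic annuli and the moments of a Lévy kernel. -/

section Shells

variable {n : ℕ}

local notation "E" => EuclideanSpace ℝ (Fin n)

theorem mem_dyadicShell {δ : ℝ} {z : E} : z ∈ dyadicShell n δ ↔ ‖z‖ < 2 * δ ∧ δ ≤ ‖z‖ := by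
  simp [dyadicShell]

theorem measurableSet_dyadicShell (δ : ℝ) : MeasurableSet (dyadicShell n δ) :=
  measurableSet_ball.diff measurableSet_ball

theorem measurable_norm_rpow (m : ℝ) : Measurable fun z : E => ‖z‖ ^ m :=
  measurable_norm.pow_const m

theorem IsLevyKernel.moment_dyadicShell {σ Λ : ℝ} {k : E → ℝ} (hk : IsLevyKernel σ Λ k) {m : ℝ}
    (hm : 0 ≤ m) {δ : ℝ} (hδ : 0 < δ) :
    IntegrableOn (fun z => ‖z‖ ^ m * k z) (dyadicShell n δ) ∧
      ∫ z in dyadicShell n δ, ‖z‖ ^ m * k z ≤ 2 ^ m * ((2 - σ) * Λ) * δ ^ (m - σ) := by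
  have hle : ∀ z ∈ dyadicShell n δ, ‖z‖ ^ m * k z ≤ (2 * δ) ^ m * k z := fun z hz =>
    mul_le_mul_of_nonneg_right
      (Real.rpow_le_rpow (norm_nonneg _) (mem_dyadicShell.1 hz).1.le hm) (hk.nonneg z)
  have hi := hk.integrableOn δ hδ
  have hi' : IntegrableOn (fun z => ‖z‖ ^ m * k z) (dyadicShell n δ) := by
    refine Integrable.mono' (hi.const_mul ((2 * δ) ^ m))
      ((measurable_norm_rpow m).aestronglyMeasurable.mul hi.aestronglyMeasurable) ?_
    refine (ae_restrict_iff' (measurableSet_dyadicShell δ)).2 (Filter.Eventually.of_forall ?_)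
    intro z hz
    rw [Real.norm_of_nonneg (mul_nonneg (by positivity) (hk.nonneg z))]
    exact hle z hz
  refine ⟨hi', ?_⟩
  calc ∫ z in dyadicShell n δ, ‖z‖ ^ m * k z
      ≤ ∫ z in dyadicShell n δ, (2 * δ) ^ m * k z :=
        setIntegral_mono_on hi' (hi.const_mul _) (measurableSet_dyadicShell δ) hle
    _ = (2 * δ) ^ m * ∫ z in dyadicShell n δ, k z := integral_const_mul _ _
    _ ≤ (2 * δ) ^ m * ((2 - σ) * Λ * δ ^ (-σ)) :=
        mul_le_mul_of_nonneg_left (hk.mass_le δ hδ) (by positivity)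
    _ = 2 ^ m * ((2 - σ) * Λ) * δ ^ (m - σ) := by
        rw [Real.mul_rpow (by norm_num) hδ.le, sub_eq_add_neg m, Real.rpow_add hδ]; ring

theorem disjoint_dyadicShell {a b : ℝ} (h : 2 * a ≤ b) :
    Disjoint (dyadicShell n a) (dyadicShell n b) := by
  rw [Set.disjoint_left]
  intro z hz hz'
  have := (mem_dyadicShell.1 hz).1
  have := (mem_dyadicShell.1 hz').2
  linarith

theorem pairwise_disjoint_dyadicShell_two {ρ : ℝ} (hρ : 0 < ρ) :
    Pairwise (Function.onFun Disjoint fun i : ℕ => dyadicShell n (ρ * 2 ^ i)) := by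
  refine (pairwise_disjoint_on _).2 fun i j hij => disjoint_dyadicShell ?_
  have : (2 : ℝ) ^ (i + 1) ≤ 2 ^ j := pow_le_pow_right₀ (by norm_num) hij
  rw [pow_succ] at this
  nlinarith

theorem pairwise_disjoint_dyadicShell_half {ρ : ℝ} (hρ : 0 < ρ) :
    Pairwise (Function.onFun Disjoint fun i : ℕ => dyadicShell n (ρ * (1 / 2) ^ i)) := by
  refine (pairwise_disjoint_on _).2 fun i j hij => (disjoint_dyadicShell ?_).symm
  have : (1 / 2 : ℝ) ^ j ≤ (1 / 2) ^ (i + 1) :=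
    pow_le_pow_of_le_one (by norm_num) (by norm_num) hij
  rw [pow_succ] at this
  nlinarith

theorem iUnion_dyadicShell_two {ρ : ℝ} (hρ : 0 < ρ) :
    ⋃ i : ℕ, dyadicShell n (ρ * 2 ^ i) = (Metric.ball (0 : E) ρ)ᶜ := by
  ext z
  simp only [Set.mem_iUnion, mem_dyadicShell, Set.mem_compl_iff, mem_ball_zero_iff, not_lt]
  constructor
  · rintro ⟨i, -, h⟩
    exact le_trans (le_mul_of_one_le_right hρ.le (one_le_pow₀ (by norm_num))) h
  · intro h
    obtain ⟨i, h1, h2⟩ := exists_nat_pow_near ((one_le_div hρ).2 h) (one_lt_two (α := ℝ))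
    rw [le_div_iff₀ hρ] at h1
    rw [div_lt_iff₀ hρ, pow_succ] at h2
    exact ⟨i, by linarith, by linarith⟩

theorem iUnion_dyadicShell_half {ρ : ℝ} (hρ : 0 < ρ) :
    ⋃ i : ℕ, dyadicShell n (ρ / 2 * (1 / 2) ^ i) = Metric.ball (0 : E) ρ \ {0} := by
  ext z
  simp only [Set.mem_iUnion, mem_dyadicShell, Set.mem_sdiff, mem_ball_zero_iff,
    Set.mem_singleton_iff]
  constructor
  · rintro ⟨i, h1, h2⟩
    have h3 : (1 / 2 : ℝ) ^ i ≤ 1 := pow_le_one₀ (by norm_num) (by norm_num)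
    have h4 : (0 : ℝ) < (1 / 2 : ℝ) ^ i := by positivity
    refine ⟨by nlinarith, fun h0 => ?_⟩
    rw [h0, norm_zero] at h2
    have : 0 < ρ / 2 * (1 / 2) ^ i := by positivity
    linarith
  · rintro ⟨h, h0⟩
    have hz : 0 < ‖z‖ := norm_pos_iff.2 h0
    obtain ⟨i, h1, h2⟩ := exists_nat_pow_near_of_lt_one (div_pos hz hρ)
      ((div_le_one hρ).2 h.le) (by norm_num : (0 : ℝ) < 1 / 2) (by norm_num)
    rw [div_le_iff₀ hρ] at h2
    rw [lt_div_iff₀ hρ, pow_succ] at h1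
    -- The shells contain their inner sphere and omit the outer one, so a point with `‖z‖ = ρ * (1 /
    -- 2) ^ i` belongs to the shell of index `i - 1`; `i = 0` is excluded by `‖z‖ < ρ`.
    rcases h2.lt_or_eq with h2 | h2
    · exact ⟨i, by linarith, by linarith⟩
    · rcases i with _ | i
      · simp at h2; linarith
      · refine ⟨i, ?_, ?_⟩ <;> rw [h2, pow_succ] <;>
          nlinarith [mul_pos hρ (by positivity : (0 : ℝ) < (1 / 2) ^ i)]

/-- The shell moments scale like `δ ^ (m - σ)`, so going outwards they form a geometric series of
ratio `2 ^ (m - σ)`, convergent because `m < σ`. -/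
theorem IsLevyKernel.moment_compl_ball {σ Λ : ℝ} {k : E → ℝ} (hk : IsLevyKernel σ Λ k) {m : ℝ}
    (hm : 0 ≤ m) (hmσ : m < σ) {ρ : ℝ} (hρ : 0 < ρ) :
    IntegrableOn (fun z => ‖z‖ ^ m * k z) (Metric.ball 0 ρ)ᶜ ∧
      ∫ z in (Metric.ball 0 ρ)ᶜ, ‖z‖ ^ m * k z ≤
        2 ^ m * ((2 - σ) * Λ) / (1 - 2 ^ (m - σ)) * ρ ^ (m - σ) := by
  have h := integrableOn_iUnion_and_integral_le_of_geometric
    (μ := volume) (s := fun i : ℕ => dyadicShell n (ρ * 2 ^ i)) (f := fun z => ‖z‖ ^ m * k z)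
    (B := 2 ^ m * ((2 - σ) * Λ) * ρ ^ (m - σ)) (q := 2 ^ (m - σ))
    (fun i => measurableSet_dyadicShell _) (pairwise_disjoint_dyadicShell_two hρ)
    (fun z => mul_nonneg (by positivity) (hk.nonneg z))
    (fun i => (hk.moment_dyadicShell hm (by positivity)).1) (by positivity)
    (Real.rpow_lt_one_of_one_lt_of_neg (by norm_num) (by linarith))
    (fun i => by
      refine (hk.moment_dyadicShell hm (by positivity)).2.trans_eq ?_
      rw [Real.mul_rpow hρ.le (by positivity), ← Real.rpow_natCast, ← Real.rpow_natCast,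
        ← Real.rpow_mul (by norm_num), ← Real.rpow_mul (by norm_num)]
      ring_nf)
  rw [iUnion_dyadicShell_two hρ] at h
  exact ⟨h.1, h.2.trans_eq (by ring)⟩

theorem ball_ae_eq_diff_zero (hn : 1 ≤ n) (ρ : ℝ) :
    (Metric.ball (0 : E) ρ \ {0} : Set E) =ᵐ[volume] Metric.ball (0 : E) ρ := by
  have : Nonempty (Fin n) := ⟨⟨0, hn⟩⟩
  exact sdiff_null_ae_eq_self (measure_singleton _)

/-- Going inwards the ratio is `(1 / 2) ^ (m - σ)`, convergent because `σ < m`. The shells miss only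
the origin, which is null for `n ≥ 1`. -/
theorem IsLevyKernel.moment_ball (hn : 1 ≤ n) {σ Λ : ℝ} {k : E → ℝ} (hk : IsLevyKernel σ Λ k)
    {m : ℝ} (hm : 0 ≤ m) (hmσ : σ < m) {ρ : ℝ} (hρ : 0 < ρ) :
    IntegrableOn (fun z => ‖z‖ ^ m * k z) (Metric.ball 0 ρ) ∧
      ∫ z in Metric.ball 0 ρ, ‖z‖ ^ m * k z ≤
        2 ^ m * ((2 - σ) * Λ) / (1 - (1 / 2) ^ (m - σ)) * (ρ / 2) ^ (m - σ) := by
  have hρ2 : 0 < ρ / 2 := by positivity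
  have h := integrableOn_iUnion_and_integral_le_of_geometric
    (μ := volume) (s := fun i : ℕ => dyadicShell n (ρ / 2 * (1 / 2) ^ i))
    (f := fun z => ‖z‖ ^ m * k z)
    (B := 2 ^ m * ((2 - σ) * Λ) * (ρ / 2) ^ (m - σ)) (q := (1 / 2) ^ (m - σ))
    (fun i => measurableSet_dyadicShell _) (pairwise_disjoint_dyadicShell_half hρ2)
    (fun z => mul_nonneg (by positivity) (hk.nonneg z))
    (fun i => (hk.moment_dyadicShell hm (by positivity)).1) (by positivity)
    (Real.rpow_lt_one (by norm_num) (by norm_num) (by linarith))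
    (fun i => by
      refine (hk.moment_dyadicShell hm (by positivity)).2.trans_eq ?_
      rw [Real.mul_rpow hρ2.le (by positivity), ← Real.rpow_natCast, ← Real.rpow_natCast,
        ← Real.rpow_mul (by norm_num), ← Real.rpow_mul (by norm_num)]
      ring_nf)
  rw [iUnion_dyadicShell_half hρ] at h
  rw [setIntegral_congr_set (ball_ae_eq_diff_zero hn ρ)] at h
  exact ⟨h.1.congr_set_ae (ball_ae_eq_diff_zero hn ρ).symm, h.2.trans_eq (by ring)⟩

theorem IsLevyKernel.integrableOn_compl_ball {σ Λ : ℝ} {k : E → ℝ} (hk : IsLevyKernel σ Λ k)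
    (hσ : 0 < σ) {ρ : ℝ} (hρ : 0 < ρ) : IntegrableOn k (Metric.ball 0 ρ)ᶜ := by
  simpa using (hk.moment_compl_ball le_rfl hσ hρ).1

/-- For order one the annular first moments vanish, so that first moments over `B_1 \ B_ρ` stay
bounded as `ρ → 0`. -/
theorem IsLevyKernel.norm_moment_ball_one_diff_le {Λ : ℝ} {k : E → ℝ} (hk : IsLevyKernel 1 Λ k)
    (hΛ : 0 < Λ) {ρ : ℝ} (hρ : 0 < ρ) (hρ1 : ρ ≤ 1) :
    ‖∫ z in Metric.ball 0 1 \ Metric.ball 0 ρ, k z • z‖ ≤ 2 * Λ := by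
  have hint : ∀ R, IntegrableOn (fun z => k z • z) (Metric.ball 0 R \ Metric.ball 0 ρ) := by
    intro R
    have h1 : IntegrableOn k (Metric.ball 0 R \ Metric.ball 0 ρ) :=
      (hk.integrableOn_compl_ball one_pos hρ).mono_set fun z hz => hz.2
    refine Integrable.mono' (h1.mul_const R)
      (h1.aestronglyMeasurable.smul measurable_id.aestronglyMeasurable) ?_
    refine (ae_restrict_iff' (measurableSet_ball.diff measurableSet_ball)).2
      (Filter.Eventually.of_forall fun z hz => ?_)
    rw [norm_smul, Real.norm_of_nonneg (hk.nonneg z)]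
    exact mul_le_mul_of_nonneg_left (mem_ball_zero_iff.1 hz.1).le (hk.nonneg z)
  have hzero : ∀ N : ℕ, ∫ z in Metric.ball 0 (ρ * 2 ^ N) \ Metric.ball 0 ρ, k z • z = 0 := by
    intro N
    induction N with
    | zero => simp
    | succ N ih =>
      have hρN : ρ ≤ ρ * 2 ^ N := le_mul_of_one_le_right hρ.le (one_le_pow₀ (by norm_num))
      have hu : Metric.ball (0 : E) (ρ * 2 ^ (N + 1)) \ Metric.ball 0 ρ =
          (Metric.ball 0 (ρ * 2 ^ N) \ Metric.ball 0 ρ) ∪ dyadicShell n (ρ * 2 ^ N) := by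
        ext z
        simp only [Set.mem_sdiff, Set.mem_union, mem_ball_zero_iff, mem_dyadicShell, pow_succ]
        constructor
        · rintro ⟨h1, h2⟩
          rcases lt_or_ge ‖z‖ (ρ * 2 ^ N) with h | h
          · exact Or.inl ⟨h, h2⟩
          · exact Or.inr ⟨by linarith, h⟩
        · rintro (⟨h1, h2⟩ | ⟨h1, h2⟩)
          · exact ⟨by linarith, h2⟩
          · exact ⟨by linarith, by linarith⟩
      have hdis : Disjoint (Metric.ball (0 : E) (ρ * 2 ^ N) \ Metric.ball 0 ρ)
          (dyadicShell n (ρ * 2 ^ N)) := by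
        rw [Set.disjoint_left]
        intro z hz hz'
        exact hz'.2 hz.1
      have hm := hk.moment_le (ρ * 2 ^ N) (by positivity)
      simp only [sub_self, abs_zero, mul_zero, zero_mul, norm_le_zero_iff] at hm
      rw [hu, setIntegral_union hdis (measurableSet_dyadicShell _) (hint _)
        ((hint (ρ * 2 ^ (N + 1))).mono_set (hu ▸ Set.subset_union_right)), ih, hm, add_zero]
  -- With `ρ * 2 ^ N ≤ 1 < ρ * 2 ^ (N + 1)`, complete shells cancel and the remainder lies in one
  -- shell of radius above `1 / 2`, where the mass bound suffices.
  obtain ⟨N, h1, h2⟩ := exists_nat_pow_near ((one_le_div hρ).2 hρ1) (one_lt_two (α := ℝ))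
  rw [le_div_iff₀ hρ] at h1
  rw [div_lt_iff₀ hρ, pow_succ] at h2
  have hρN : ρ ≤ ρ * 2 ^ N := le_mul_of_one_le_right hρ.le (one_le_pow₀ (by norm_num))
  have hδ : 0 < ρ * 2 ^ N := by positivity
  have hu : Metric.ball (0 : E) 1 \ Metric.ball 0 ρ =
      (Metric.ball 0 (ρ * 2 ^ N) \ Metric.ball 0 ρ) ∪
        (Metric.ball 0 1 \ Metric.ball 0 (ρ * 2 ^ N)) := by
    ext z
    simp only [Set.mem_sdiff, Set.mem_union, mem_ball_zero_iff]
    constructor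
    · rintro ⟨h3, h4⟩
      rcases lt_or_ge ‖z‖ (ρ * 2 ^ N) with h | h
      · exact Or.inl ⟨h, h4⟩
      · exact Or.inr ⟨h3, not_lt.2 h⟩
    · rintro (⟨h3, h4⟩ | ⟨h3, h4⟩)
      · exact ⟨by linarith, h4⟩
      · exact ⟨h3, by linarith⟩
  have hdis : Disjoint (Metric.ball (0 : E) (ρ * 2 ^ N) \ Metric.ball 0 ρ)
      (Metric.ball 0 1 \ Metric.ball 0 (ρ * 2 ^ N)) := by
    rw [Set.disjoint_left]
    intro z hz hz'
    exact hz'.2 hz.1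
  have hsub : Metric.ball (0 : E) 1 \ Metric.ball 0 (ρ * 2 ^ N) ⊆ dyadicShell n (ρ * 2 ^ N) :=
    Set.sdiff_subset_sdiff_left (Metric.ball_subset_ball (by linarith))
  rw [hu, setIntegral_union hdis (measurableSet_ball.diff measurableSet_ball) (hint _)
    ((hint 1).mono_set (hu ▸ Set.subset_union_right)), hzero, zero_add]
  have hi := hk.integrableOn _ hδ
  calc ‖∫ z in Metric.ball 0 1 \ Metric.ball 0 (ρ * 2 ^ N), k z • z‖
      ≤ ∫ z in Metric.ball 0 1 \ Metric.ball 0 (ρ * 2 ^ N), k z := by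
        refine norm_integral_le_of_norm_le (hi.mono_set hsub) ?_
        refine (ae_restrict_iff' (measurableSet_ball.diff measurableSet_ball)).2
          (Filter.Eventually.of_forall fun z hz => ?_)
        rw [norm_smul, Real.norm_of_nonneg (hk.nonneg z)]
        exact mul_le_of_le_one_right (hk.nonneg z) (mem_ball_zero_iff.1 hz.1).le
    _ ≤ ∫ z in dyadicShell n (ρ * 2 ^ N), k z :=
        setIntegral_mono_set hi (Filter.Eventually.of_forall hk.nonneg)
          (Filter.Eventually.of_forall hsub)
    _ ≤ (2 - 1) * Λ * (ρ * 2 ^ N) ^ (-1 : ℝ) := hk.mass_le _ hδ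
    _ ≤ 2 * Λ := by
        rw [Real.rpow_neg_one]
        have : (ρ * 2 ^ N)⁻¹ ≤ 2 := by
          rw [inv_le_comm₀ hδ (by norm_num)]
          linarith
        nlinarith

end Shells

/-! ### Increments of test functions and their integrability. -/

section Increments

variable {n : ℕ}

local notation "E" => EuclideanSpace ℝ (Fin n)

/-- The compensating vector field of a Lévy operator of order `σ`. -/
def compensator (σ : ℝ) (z : E) : E :=
  if σ < 1 then 0 else if σ = 1 then (Metric.ball 0 1).indicator id z else z

theorem levyIncrement_eq (σ : ℝ) (u : E → ℝ) (x z : E) :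
    levyIncrement σ u x z = u (x + z) - u x - fderiv ℝ u x (compensator σ z) := by
  unfold levyIncrement compensator
  split_ifs with h1 h2
  · simp
  · by_cases hz : z ∈ Metric.ball (0 : E) 1 <;> simp [hz]
  · rfl

theorem measurable_compensator (σ : ℝ) : Measurable (compensator σ : E → E) := by
  unfold compensator
  split_ifs
  · exact measurable_const
  · exact measurable_id.indicator measurableSet_ball
  · exact measurable_id

theorem norm_compensator_le (σ : ℝ) (z : E) : ‖compensator σ z‖ ≤ ‖z‖ := by
  unfold compensator
  split_ifs
  · simp
  · exact norm_indicator_le_norm_self id z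
  · exact le_rfl

/-- Near the origin the increment is bounded by this power of the distance. -/
def incrementOrder (σ : ℝ) : ℝ := if σ < 1 then 1 else 2

theorem lt_incrementOrder {σ : ℝ} (h : σ < 2) : σ < incrementOrder σ := by
  unfold incrementOrder; split_ifs <;> assumption

theorem incrementOrder_nonneg (σ : ℝ) : 0 ≤ incrementOrder σ := by
  unfold incrementOrder; split_ifs <;> norm_num

/-- The derivative is `C¹`, hence Lipschitz near `x`; the mean value inequality on the ball of
radius `‖z‖` gives the quadratic bound. -/
theorem exists_abs_increment_le_sq {φ : E → ℝ} (hφ : ContDiff ℝ 2 φ) (x : E) :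
    ∃ ρ L : ℝ, 0 < ρ ∧ 0 ≤ L ∧
      ∀ z, ‖z‖ < ρ → |φ (x + z) - φ x - fderiv ℝ φ x z| ≤ L * ‖z‖ ^ 2 := by
  have h1 : ContDiffAt ℝ 1 (fderiv ℝ φ) x :=
    (hφ.fderiv_right (m := 1) (by norm_num)).contDiffAt
  obtain ⟨L, t, ht, hL⟩ := h1.exists_lipschitzOnWith
  obtain ⟨ρ, hρ, hball⟩ := Metric.mem_nhds_iff.1 ht
  refine ⟨ρ, L, hρ, L.2, fun z hz => ?_⟩
  have hsub : Metric.closedBall x ‖z‖ ⊆ t :=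
    (Metric.closedBall_subset_ball hz).trans hball
  have hx : x ∈ Metric.closedBall x ‖z‖ := Metric.mem_closedBall_self (norm_nonneg _)
  have := (convex_closedBall x ‖z‖).norm_image_sub_le_of_norm_fderiv_le' (𝕜 := ℝ) (f := φ)
    (φ := fderiv ℝ φ x) (C := L * ‖z‖) (y := x + z)
    (fun w _ => (hφ.differentiable (by norm_num)) w)
    (fun w hw => by
      have h := hL.dist_le_mul w (hsub hw) x (hsub hx)
      rw [dist_eq_norm] at h
      exact h.trans (mul_le_mul_of_nonneg_left (Metric.mem_closedBall.1 hw) L.2)) hx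
    (by simp [Metric.mem_closedBall])
  rw [add_sub_cancel_left, Real.norm_eq_abs] at this
  exact this.trans_eq (by ring)

/-- For `σ ≤ 1` the compensator has norm at most one, so finite mass suffices; for `σ > 1` the first
moment converges at infinity. -/
theorem IsLevyKernel.integrableOn_compensator {σ Λ : ℝ} {k : E → ℝ} (hk : IsLevyKernel σ Λ k)
    (hσ0 : 0 < σ) {ρ : ℝ} (hρ : 0 < ρ) :
    IntegrableOn (fun z => k z • compensator σ z) (Metric.ball 0 ρ)ᶜ := by
  have hk0 := hk.integrableOn_compl_ball hσ0 hρ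
  have hmeas : AEStronglyMeasurable (fun z => k z • compensator σ z)
      (volume.restrict (Metric.ball 0 ρ)ᶜ) :=
    hk0.aestronglyMeasurable.smul (measurable_compensator σ).aestronglyMeasurable
  by_cases h1 : σ ≤ 1
  · refine Integrable.mono' hk0 hmeas (Filter.Eventually.of_forall fun z => ?_)
    rw [norm_smul, Real.norm_of_nonneg (hk.nonneg z)]
    refine mul_le_of_le_one_right (hk.nonneg z) ?_
    unfold compensator
    split_ifs with h2 h3
    · simp
    · by_cases hz : z ∈ Metric.ball (0 : E) 1
      · simpa [hz] using (mem_ball_zero_iff.1 hz).le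
      · simp [hz]
    · exact absurd (lt_of_le_of_ne h1 h3) h2
  · refine Integrable.mono' (hk.moment_compl_ball zero_le_one (not_le.1 h1) hρ).1 hmeas
      (Filter.Eventually.of_forall fun z => ?_)
    rw [norm_smul, Real.norm_of_nonneg (hk.nonneg z), Real.rpow_one, mul_comm]
    exact mul_le_mul_of_nonneg_right (norm_compensator_le σ z) (hk.nonneg z)

theorem IsLevyKernel.integrableOn_sub_mul {σ Λ : ℝ} {k : E → ℝ} (hk : IsLevyKernel σ Λ k)
    (hσ0 : 0 < σ) {ρ : ℝ} (hρ : 0 < ρ) {φ : E → ℝ} (hφ : IsTestFunction φ) (x : E) :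
    IntegrableOn (fun z => (φ (x + z) - φ x) * k z) (Metric.ball 0 ρ)ᶜ := by
  obtain ⟨hc, M, hM⟩ := hφ
  refine (hk.integrableOn_compl_ball hσ0 hρ).bdd_mul (c := 2 * M)
    (by have := hc.continuous; fun_prop) (Filter.Eventually.of_forall fun z => ?_)
  rw [Real.norm_eq_abs]
  refine (abs_sub _ _).trans ?_
  linarith [hM (x + z), hM x]

theorem IsLevyKernel.integrable_levyIncrement (hn : 1 ≤ n) {σ Λ : ℝ} {k : E → ℝ}
    (hk : IsLevyKernel σ Λ k) (hσ0 : 0 < σ) (hσ2 : σ < 2) {φ : E → ℝ} (hφ : IsTestFunction φ)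
    (x : E) : Integrable fun z => levyIncrement σ φ x z * k z := by
  obtain ⟨ρ, L, hρ, hL, hloc⟩ := exists_abs_increment_le_sq hφ.1 x
  have hfar : ∀ r, 0 < r →
      IntegrableOn (fun z => levyIncrement σ φ x z * k z) (Metric.ball 0 r)ᶜ := by
    intro r hr
    refine ((hk.integrableOn_sub_mul hσ0 hr hφ x).sub
      ((fderiv ℝ φ x).integrable_comp (hk.integrableOn_compensator hσ0 hr))).congr
      (Filter.Eventually.of_forall fun z => ?_)
    simp only [levyIncrement_eq, Pi.sub_apply, map_smul, smul_eq_mul]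
    ring
  -- A radius at most one allows `‖z‖ ^ 2 ≤ ‖z‖` and makes the truncation at order one inactive.
  set r := min ρ 1 with hr
  have hr0 : 0 < r := lt_min hρ one_pos
  have hnear : IntegrableOn (fun z => levyIncrement σ φ x z * k z) (Metric.ball 0 r) := by
    have hm := (hk.moment_ball hn (incrementOrder_nonneg σ) (lt_incrementOrder hσ2) hr0).1
    have hmeas : AEStronglyMeasurable (fun z => levyIncrement σ φ x z * k z) := by
      -- Measurability of `k` is available only through integrability on shells; these and the
      -- exterior of the unit ball cover the space up to the origin.
      have hcover : ((⋃ i : ℕ, dyadicShell n (1 / 2 * (1 / 2) ^ i)) ∪ (Metric.ball (0 : E) 1)ᶜ :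
          Set E) =ᵐ[volume] (Set.univ : Set E) := by
        rw [iUnion_dyadicShell_half one_pos]
        rw [← Set.union_compl_self (Metric.ball (0 : E) 1)]
        exact ae_eq_set_union (ball_ae_eq_diff_zero hn 1) Filter.EventuallyEq.rfl
      have hkm : AEStronglyMeasurable k := by
        have h : AEStronglyMeasurable k (volume.restrict
            ((⋃ i : ℕ, dyadicShell n (1 / 2 * (1 / 2) ^ i)) ∪ (Metric.ball (0 : E) 1)ᶜ)) := by
          refine aestronglyMeasurable_union_iff.2 ⟨?_,
            (hk.integrableOn_compl_ball hσ0 one_pos).aestronglyMeasurable⟩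
          exact AEStronglyMeasurable.iUnion fun i =>
            (hk.integrableOn _ (by positivity)).aestronglyMeasurable
        rwa [Measure.restrict_congr_set hcover, Measure.restrict_univ] at h
      refine AEStronglyMeasurable.mul ?_ hkm
      have h1 := hφ.1.continuous
      have h2 : Measurable fun z => fderiv ℝ φ x (compensator σ z) :=
        (fderiv ℝ φ x).continuous.measurable.comp (measurable_compensator σ)
      simp only [funext (levyIncrement_eq σ φ x)]
      exact (by fun_prop : Measurable fun z => φ (x + z) - φ x).aestronglyMeasurable.sub
        h2.aestronglyMeasurable
    refine Integrable.mono' (hm.const_mul (L + ‖fderiv ℝ φ x‖)) hmeas.restrict ?_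
    refine (ae_restrict_iff' measurableSet_ball).2 (Filter.Eventually.of_forall fun z hz => ?_)
    have hz' : ‖z‖ < r := mem_ball_zero_iff.1 hz
    have hz1 : ‖z‖ < 1 := hz'.trans_le (min_le_right _ _)
    have hq := hloc z (hz'.trans_le (min_le_left _ _))
    rw [norm_mul, Real.norm_eq_abs, Real.norm_of_nonneg (hk.nonneg z), ← mul_assoc]
    refine mul_le_mul_of_nonneg_right ?_ (hk.nonneg z)
    have hD := (fderiv ℝ φ x).le_opNorm z
    rw [Real.norm_eq_abs] at hD
    have hD0 := norm_nonneg (fderiv ℝ φ x)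
    have hz0 := norm_nonneg z
    unfold levyIncrement incrementOrder
    split_ifs with h1 h2
    · rw [Real.rpow_one]
      have h3 : |φ (x + z) - φ x| ≤ L * ‖z‖ ^ 2 + ‖fderiv ℝ φ x‖ * ‖z‖ := by
        have := abs_add_le (φ (x + z) - φ x - fderiv ℝ φ x z) (fderiv ℝ φ x z)
        rw [sub_add_cancel] at this
        linarith
      nlinarith [mul_nonneg hL hz0]
    · rw [Set.indicator_of_mem (mem_ball_zero_iff.2 hz1), Real.rpow_two]
      nlinarith [mul_nonneg hD0 (sq_nonneg ‖z‖)]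
    · rw [Real.rpow_two]
      nlinarith [mul_nonneg hD0 (sq_nonneg ‖z‖)]
  have := hnear.union (hfar r hr0)
  rwa [Set.union_compl_self, integrableOn_univ] at this

end Increments

/-! ### Powers of the distance to a ball and the main nonlocal estimate. -/

section Barrier

variable {n : ℕ}

local notation "E" => EuclideanSpace ℝ (Fin n)

/-- The compensator is absent for `σ < 1`; for `σ = 1` the cancellation of annular moments replaces
an absolute moment that could grow logarithmically; for `σ > 1` the absolute first moment has the
right size. -/
theorem exists_norm_integral_compensator_le {σ Λ : ℝ} (hσ0 : 0 < σ) (hσ2 : σ < 2) (hΛ : 0 < Λ) :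
    ∃ C : ℝ, 0 ≤ C ∧ ∀ k : E → ℝ, IsLevyKernel σ Λ k → ∀ ρ : ℝ, 0 < ρ → ρ ≤ 1 →
      ‖∫ z in (Metric.ball 0 ρ)ᶜ, k z • compensator σ z‖ ≤ C * ρ ^ (1 - σ) := by
  rcases lt_trichotomy σ 1 with h | h | h
  · exact ⟨0, le_rfl, fun k _ ρ _ _ => by simp [compensator, h]⟩
  · subst h
    refine ⟨2 * Λ, by positivity, fun k hk ρ hρ hρ1 => ?_⟩
    have heq : ∀ z : E, k z • compensator 1 z =
        (Metric.ball (0 : E) 1).indicator (fun z => k z • z) z := by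
      intro z
      by_cases hz : z ∈ Metric.ball (0 : E) 1 <;> simp [compensator, hz]
    simp only [heq]
    rw [setIntegral_indicator measurableSet_ball, sub_self, Real.rpow_zero, mul_one,
      Set.inter_comm, ← Set.sdiff_eq]
    exact hk.norm_moment_ball_one_diff_le hΛ hρ hρ1
  · have hpos : (0 : ℝ) < 1 - 2 ^ (1 - σ) :=
      sub_pos.2 (Real.rpow_lt_one_of_one_lt_of_neg (by norm_num) (by linarith))
    have h2 : 0 < 2 - σ := by linarith
    refine ⟨2 ^ (1 : ℝ) * ((2 - σ) * Λ) / (1 - 2 ^ (1 - σ)), by positivity,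
      fun k hk ρ hρ _ => ?_⟩
    obtain ⟨hi, hle⟩ := hk.moment_compl_ball zero_le_one h hρ
    refine (norm_integral_le_of_norm_le hi (Filter.Eventually.of_forall fun z => ?_)).trans hle
    rw [norm_smul, Real.norm_of_nonneg (hk.nonneg z), Real.rpow_one, mul_comm]
    exact mul_le_mul_of_nonneg_right (norm_compensator_le σ z) (hk.nonneg z)

/-- A power of the distance to the ball of radius `r` centred at `p`. -/
def ballBarrier (α r : ℝ) (p y : E) : ℝ := max (‖y - p‖ - r) 0 ^ α

theorem ballBarrier_nonneg (α r : ℝ) (p y : E) : 0 ≤ ballBarrier α r p y :=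
  Real.rpow_nonneg (le_max_right _ _) _

/-- Expand `‖v + z‖ ^ 2` and use `2 * ‖v‖ * ‖v + z‖ ≤ ‖v‖ ^ 2 + ‖v + z‖ ^ 2`. -/
theorem norm_add_le_second_order {v z : E} (hv : v ≠ 0) :
    ‖v + z‖ ≤ ‖v‖ + inner ℝ (‖v‖⁻¹ • v) z + ‖z‖ ^ 2 / (2 * ‖v‖) := by
  have hv0 : 0 < ‖v‖ := norm_pos_iff.2 hv
  have h1 := norm_add_sq_real v z
  rw [real_inner_smul_left]
  set a := ‖v‖
  set i := inner ℝ v z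
  have h2 : 2 * a * (a + a⁻¹ * i + ‖z‖ ^ 2 / (2 * a)) = a ^ 2 + ‖v + z‖ ^ 2 := by
    rw [h1]; field_simp; ring
  nlinarith [sq_nonneg (a - ‖v + z‖)]

/-- By concavity `t ^ α` lies below its tangent at `d` (Bernoulli), and the distance has a
second-order upper expansion. The restriction `‖z‖ < d / 2` keeps `y + z` outside the ball. -/
theorem ballBarrier_add_sub_le_near {α r d : ℝ} (hα0 : 0 ≤ α) (hα1 : α ≤ 1) (hr : 0 ≤ r)
    (hd : 0 < d) {p y z : E} (hy : ‖y - p‖ = r + d) (hz : ‖z‖ < d / 2) :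
    ballBarrier α r p (y + z) - ballBarrier α r p y ≤
      α * d ^ (α - 1) * inner ℝ (‖y - p‖⁻¹ • (y - p)) z + α * d ^ (α - 2) * ‖z‖ ^ 2 := by
  have hv : y - p ≠ 0 := norm_pos_iff.1 (by linarith)
  have hs := norm_add_le_second_order (z := z) hv
  rw [show y - p + z = y + z - p by abel] at hs
  set i := inner ℝ (‖y - p‖⁻¹ • (y - p)) z
  have hs2 : ‖z‖ ^ 2 / (2 * ‖y - p‖) ≤ ‖z‖ ^ 2 / d :=
    div_le_div_of_nonneg_left (by positivity) hd (by linarith)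
  have hlow : ‖y - p‖ - ‖z‖ ≤ ‖y + z - p‖ := by
    have := norm_sub_norm_le (y - p) (-z)
    rw [norm_neg, show y - p - -z = y + z - p by abel] at this
    linarith
  unfold ballBarrier
  rw [max_eq_left (by linarith : 0 ≤ ‖y + z - p‖ - r), hy, add_sub_cancel_left, max_eq_left hd.le]
  set s := ‖y + z - p‖ - r with hsdef
  have hs0 : 0 ≤ s := by linarith
  have hb := rpow_one_add_le_one_add_mul_self (s := s / d - 1)
    (by have := div_nonneg hs0 hd.le; linarith) hα0 hα1
  rw [add_sub_cancel, Real.div_rpow hs0 hd.le, div_le_iff₀ (by positivity)] at hb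
  have e1 : d ^ α = d ^ (α - 1) * d := by
    rw [Real.rpow_sub_one hd.ne']; field_simp
  have e2 : d ^ (α - 1) = d ^ (α - 2) * d := by
    rw [show α - 2 = α - 1 - 1 by ring, Real.rpow_sub_one hd.ne' (α - 1)]; field_simp
  have hb2 : s ^ α - d ^ α ≤ α * d ^ (α - 1) * (s - d) := by
    rw [e1] at hb ⊢
    have : (1 + α * (s / d - 1)) * (d ^ (α - 1) * d) =
      d ^ (α - 1) * d + α * d ^ (α - 1) * (s - d) := by field_simp
    linarith
  have hsd : s - d ≤ i + ‖z‖ ^ 2 / d := by linarith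
  calc s ^ α - d ^ α ≤ α * d ^ (α - 1) * (s - d) := hb2
    _ ≤ α * d ^ (α - 1) * (i + ‖z‖ ^ 2 / d) := mul_le_mul_of_nonneg_left hsd (by positivity)
    _ = α * d ^ (α - 1) * i + α * d ^ (α - 2) * ‖z‖ ^ 2 := by
        rw [mul_add, e2]; field_simp

/-- The factor `α` has to survive: convexity of the exponential extracts `α * log (1 + t)`, and the
logarithm and `(1 + t) ^ α` each cost a power `σ / 4`. The total `σ / 2` stays below `σ`, so the
tail moment converges. -/
theorem one_add_rpow_sub_one_le {σ α t : ℝ} (hσ0 : 0 < σ) (hσ2 : σ < 2) (hα0 : 0 < α)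
    (hα : α ≤ σ / 4) (ht : 1 / 2 ≤ t) :
    (1 + t) ^ α - 1 ≤ α * (12 / σ) * t ^ (σ / 2) := by
  have h1 : 0 < 1 + t := by linarith
  have hlog := Real.log_le_rpow_div h1.le (by positivity : 0 < σ / 4)
  have hlog0 : 0 ≤ Real.log (1 + t) := Real.log_nonneg (by linarith)
  have hexp : (1 + t) ^ α - 1 ≤ α * Real.log (1 + t) * (1 + t) ^ α := by
    have h := Real.add_one_le_exp (-(Real.log (1 + t) * α))
    rw [Real.exp_neg, ← Real.rpow_def_of_pos h1] at h
    have hp : 0 < (1 + t) ^ α := by positivity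
    have h' := mul_le_mul_of_nonneg_right h hp.le
    rw [inv_mul_cancel₀ hp.ne'] at h'
    linarith
  calc (1 + t) ^ α - 1 ≤ α * Real.log (1 + t) * (1 + t) ^ α := hexp
    _ ≤ α * ((1 + t) ^ (σ / 4) / (σ / 4)) * (1 + t) ^ (σ / 4) :=
        mul_le_mul (mul_le_mul_of_nonneg_left hlog hα0.le)
          (Real.rpow_le_rpow_of_exponent_le (by linarith) hα) (by positivity) (by positivity)
    _ = α * (4 / σ) * (1 + t) ^ (σ / 2) := by
        rw [show σ / 2 = σ / 4 + σ / 4 by ring, Real.rpow_add h1]; field_simp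
    _ ≤ α * (4 / σ) * (3 * t ^ (σ / 2)) := by
        refine mul_le_mul_of_nonneg_left ?_ (by positivity)
        calc (1 + t) ^ (σ / 2) ≤ (3 * t) ^ (σ / 2) :=
              Real.rpow_le_rpow h1.le (by linarith) (by positivity)
          _ = 3 ^ (σ / 2) * t ^ (σ / 2) := Real.mul_rpow (by norm_num) (by linarith)
          _ ≤ 3 * t ^ (σ / 2) := by
              refine mul_le_mul_of_nonneg_right ?_ (Real.rpow_nonneg (by linarith) _)
              exact Real.rpow_le_self_of_one_le (by norm_num) (by linarith)
    _ = α * (12 / σ) * t ^ (σ / 2) := by ring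

theorem ballBarrier_add_sub_le_far {σ α r d : ℝ} (hσ0 : 0 < σ) (hσ2 : σ < 2) (hα0 : 0 < α)
    (hα : α ≤ σ / 4) (hd : 0 < d) {p y z : E} (hy : ‖y - p‖ = r + d)
    (hz : d / 2 ≤ ‖z‖) :
    ballBarrier α r p (y + z) - ballBarrier α r p y ≤
      α * (12 / σ) * d ^ (α - σ / 2) * ‖z‖ ^ (σ / 2) := by
  unfold ballBarrier
  rw [hy, add_sub_cancel_left, max_eq_left hd.le]
  have hmax : max (‖y + z - p‖ - r) 0 ≤ d * (1 + ‖z‖ / d) := by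
    have h1 := norm_add_le (y - p) z
    rw [show y - p + z = y + z - p by abel] at h1
    have h2 : d * (1 + ‖z‖ / d) = d + ‖z‖ := by field_simp
    rw [h2]
    exact max_le (by linarith) (by positivity)
  have h := one_add_rpow_sub_one_le (t := ‖z‖ / d) hσ0 hσ2 hα0 hα (by
    rw [le_div_iff₀ hd]; linarith)
  have h3 := Real.rpow_le_rpow (le_max_right _ _) hmax hα0.le
  rw [Real.mul_rpow hd.le (by positivity)] at h3
  calc _ ≤ d ^ α * (1 + ‖z‖ / d) ^ α - d ^ α := by linarith
    _ = d ^ α * ((1 + ‖z‖ / d) ^ α - 1) := by ring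
    _ ≤ d ^ α * (α * (12 / σ) * (‖z‖ / d) ^ (σ / 2)) :=
        mul_le_mul_of_nonneg_left h (by positivity)
    _ = _ := by
        rw [Real.div_rpow (norm_nonneg _) hd.le, Real.rpow_sub hd]; field_simp

/-- After the jump the barrier is at most `(κ * d) ^ α ≤ d ^ α / 2`. Unlike the other increment
bounds, this one has no factor `α`. -/
theorem ballBarrier_add_sub_le_of_near_ball {α r d κ : ℝ} (hα0 : 0 < α)
    (hκα : κ ^ α ≤ 1 / 2) (hκ : 0 ≤ κ) (hd : 0 < d) {p y z : E} (hy : ‖y - p‖ = r + d)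
    (hz : ‖y + z - p‖ ≤ r + κ * d) :
    ballBarrier α r p (y + z) - ballBarrier α r p y ≤ -(d ^ α / 2) := by
  unfold ballBarrier
  rw [hy, add_sub_cancel_left, max_eq_left hd.le]
  have h3 := Real.rpow_le_rpow (le_max_right (‖y + z - p‖ - r) 0)
    (max_le (by linarith) (by positivity) : _ ≤ κ * d) hα0.le
  rw [Real.mul_rpow hκ hd.le] at h3
  nlinarith [Real.rpow_pos_of_pos hd α]

/-- Subtracting `ℓ z + C * ‖z‖ ^ 2` leaves a function with a local maximum at the origin, so a
one-sided bound already determines the gradient. -/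
theorem fderiv_eq_of_increment_le {φ : E → ℝ} {y : E} (hφ : DifferentiableAt ℝ φ y)
    {ℓ : E →L[ℝ] ℝ} {C ρ : ℝ} (hρ : 0 < ρ)
    (h : ∀ z, ‖z‖ < ρ → φ (y + z) - φ y ≤ ℓ z + C * ‖z‖ ^ 2) : fderiv ℝ φ y = ℓ := by
  have h1 : HasFDerivAt (fun z => φ (y + z)) (fderiv ℝ φ y) 0 := by
    rw [hasFDerivAt_comp_add_left, add_zero]
    exact hφ.hasFDerivAt
  have h2 : HasFDerivAt (fun z : E => C * ‖z‖ ^ 2) (0 : E →L[ℝ] ℝ) 0 := by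
    have := ((hasStrictFDerivAt_norm_sq (0 : E)).hasFDerivAt).const_mul C
    simpa using this
  have h3 := (h1.sub ℓ.hasFDerivAt).sub h2
  have hmax : IsLocalMax (((fun z => φ (y + z)) - ⇑ℓ) - fun z : E => C * ‖z‖ ^ 2) 0 := by
    filter_upwards [Metric.ball_mem_nhds (0 : E) hρ] with z hz
    have := h z (mem_ball_zero_iff.1 hz)
    simp only [Pi.sub_apply, add_zero, map_zero, norm_zero]
    linarith
  have h4 := hmax.hasFDerivAt_eq_zero h3
  rw [sub_zero] at h4
  exact sub_eq_zero.1 h4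

/-- The main estimate: the nonlocal operator is very negative on test functions touching from
below a multiple of a small power of the distance to a ball, provided the kernel charges the jumps
that land (almost) in that ball. -/
theorem exists_levyOp_le_of_touching_ballBarrier (hn : 1 ≤ n) {σ Λ : ℝ} (hσ0 : 0 < σ)
    (hσ2 : σ < 2) (hΛ : 0 < Λ) :
    ∃ C : ℝ, 0 ≤ C ∧ ∀ k : E → ℝ, IsLevyKernel σ Λ k → ∀ (p y : E) (r d A α κ c₀ : ℝ),
      0 ≤ r → 0 < d → d ≤ 1 → ‖y - p‖ = r + d → 0 < A → 0 < α → α ≤ σ / 4 → 0 < κ → κ ≤ 1 / 2 →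
      κ ^ α ≤ 1 / 2 → c₀ * d ^ (-σ) ≤ ∫ z in {z | ‖y + z - p‖ ≤ r + κ * d}, k z →
      ∀ φ : E → ℝ, IsTestFunction φ →
      (∀ z, φ (y + z) - φ y ≤ A * (ballBarrier α r p (y + z) - ballBarrier α r p y)) →
      levyOp σ k φ y ≤ A * d ^ (α - σ) * (C * α - c₀ / 2) ∧
        ∀ v, fderiv ℝ φ y v = A * (α * d ^ (α - 1)) * inner ℝ (‖y - p‖⁻¹ • (y - p)) v := by
  obtain ⟨C₃, hC₃, hcomp⟩ := exists_norm_integral_compensator_le (n := n) hσ0 hσ2 hΛ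
  set m := incrementOrder σ with hm
  have hmσ : σ < m := lt_incrementOrder hσ2
  have h2σ : 0 < 2 - σ := by linarith
  set C₁ := 2 ^ m * ((2 - σ) * Λ) / (1 - (1 / 2) ^ (m - σ)) with hC₁
  set C₂ := 2 ^ (σ / 2) * ((2 - σ) * Λ) / (1 - 2 ^ (σ / 2 - σ)) with hC₂
  have hC₁0 : 0 ≤ C₁ := by
    have : (0 : ℝ) < 1 - (1 / 2) ^ (m - σ) :=
      sub_pos.2 (Real.rpow_lt_one (by norm_num) (by norm_num) (by linarith))
    positivity
  have hC₂0 : 0 ≤ C₂ := by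
    have : (0 : ℝ) < 1 - 2 ^ (σ / 2 - σ) :=
      sub_pos.2 (Real.rpow_lt_one_of_one_lt_of_neg (by norm_num) (by linarith))
    positivity
  refine ⟨2 * C₁ + 12 / σ * (2 * C₂) + 2 * C₃, by positivity, ?_⟩
  intro k hk p y r d A α κ c₀ hr hd hd1 hy hA hα0 hα hκ0 hκ hκα hmass φ hφ htouch
  have hα1 : α ≤ 1 := by linarith
  have hd2 : 0 < d / 2 := by positivity
  set N : Set E := Metric.ball 0 (d / 2) with hN
  set S : Set E := {z | ‖y + z - p‖ ≤ r + κ * d} with hS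
  set ν := ‖y - p‖⁻¹ • (y - p) with hν
  have hνle : ‖ν‖ ≤ 1 := by
    rw [hν, norm_smul, norm_inv, norm_norm]
    exact inv_mul_le_one
  have hgrad : fderiv ℝ φ y = (A * (α * d ^ (α - 1))) • innerSL ℝ ν := by
    refine fderiv_eq_of_increment_le ((hφ.1.differentiable (by norm_num)) y) hd2
      (C := A * (α * d ^ (α - 2))) fun z hz => (htouch z).trans ?_
    have := mul_le_mul_of_nonneg_left
      (ballBarrier_add_sub_le_near hα0.le hα1 hr hd hy hz) hA.le
    refine this.trans_eq ?_
    simp only [smul_apply, innerSL_apply_apply, smul_eq_mul]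
    ring
  have hgrad' : ∀ v, fderiv ℝ φ y v = A * (α * d ^ (α - 1)) * inner ℝ ν v := fun v => by
    rw [hgrad]; simp
  refine ⟨?_, hgrad'⟩
  have hint := hk.integrable_levyIncrement hn hσ0 hσ2 hφ y
  have hdm : d ^ (α - 1) * d ^ (1 - m) = d ^ (α - m) := by
    rw [← Real.rpow_add hd]; ring_nf
  -- For `σ ≥ 1` the compensator cancels the linear term and a quadratic bound remains; for `σ < 1`
  -- the linear bound is integrable by itself.
  have hnear : ∫ z in N, levyIncrement σ φ y z * k z ≤ A * d ^ (α - σ) * (2 * C₁ * α) := by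
    obtain ⟨hi, hle⟩ := hk.moment_ball hn (incrementOrder_nonneg σ) hmσ hd2
    have hpt : ∀ z ∈ N, levyIncrement σ φ y z * k z ≤
        (2 * A * α * d ^ (α - m)) * (‖z‖ ^ m * k z) := by
      intro z hz
      have hz' : ‖z‖ < d / 2 := mem_ball_zero_iff.1 hz
      rw [← mul_assoc]
      refine mul_le_mul_of_nonneg_right ?_ (hk.nonneg z)
      have hb := (htouch z).trans (mul_le_mul_of_nonneg_left
        (ballBarrier_add_sub_le_near hα0.le hα1 hr hd hy hz') hA.le)
      have hpos : 0 ≤ A * (α * d ^ (α - 2)) * ‖z‖ ^ 2 := by positivity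
      have hg := hgrad' z
      rw [levyIncrement_eq, hm]
      unfold compensator incrementOrder
      split_ifs with h1 h2
      · rw [map_zero, sub_zero, Real.rpow_one]
        have hin : inner ℝ ν z ≤ ‖z‖ :=
          (real_inner_le_norm ν z).trans (mul_le_of_le_one_left (norm_nonneg _) hνle)
        have hz2 : d ^ (α - 2) * ‖z‖ ^ 2 ≤ d ^ (α - 1) * ‖z‖ := by
          have e2 : d ^ (α - 1) = d ^ (α - 2) * d := by
            rw [show α - 2 = α - 1 - 1 by ring, Real.rpow_sub_one hd.ne' (α - 1)]; field_simp
          rw [e2, mul_assoc, sq]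
          exact mul_le_mul_of_nonneg_left
            (mul_le_mul_of_nonneg_right (by linarith) (norm_nonneg _)) (by positivity)
        have hAα : 0 ≤ A * α := by positivity
        calc φ (y + z) - φ y ≤ A * α * (d ^ (α - 1) * inner ℝ ν z + d ^ (α - 2) * ‖z‖ ^ 2) :=
              hb.trans_eq (by ring)
          _ ≤ A * α * (d ^ (α - 1) * ‖z‖ + d ^ (α - 1) * ‖z‖) :=
              mul_le_mul_of_nonneg_left
                (add_le_add (mul_le_mul_of_nonneg_left hin (by positivity)) hz2) hAα
          _ = _ := by ring
      · rw [Set.indicator_of_mem (mem_ball_zero_iff.2 (by linarith)), Real.rpow_two, id, hg]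
        linarith
      · rw [Real.rpow_two, hg]
        linarith
    calc ∫ z in N, levyIncrement σ φ y z * k z
        ≤ ∫ z in N, (2 * A * α * d ^ (α - m)) * (‖z‖ ^ m * k z) :=
          setIntegral_mono_on hint.integrableOn (hi.const_mul _) measurableSet_ball hpt
      _ = (2 * A * α * d ^ (α - m)) * ∫ z in N, ‖z‖ ^ m * k z := integral_const_mul _ _
      _ ≤ (2 * A * α * d ^ (α - m)) * (C₁ * (d / 2 / 2) ^ (m - σ)) :=
          mul_le_mul_of_nonneg_left hle (by positivity)
      _ ≤ (2 * A * α * d ^ (α - m)) * (C₁ * d ^ (m - σ)) := by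
          refine mul_le_mul_of_nonneg_left (mul_le_mul_of_nonneg_left ?_ hC₁0) (by positivity)
          exact Real.rpow_le_rpow (by positivity) (by linarith) (by linarith)
      _ = A * (d ^ (α - m) * d ^ (m - σ)) * (2 * C₁ * α) := by ring
      _ = _ := by rw [← Real.rpow_add hd]; ring_nf
  have hcompint : -(fderiv ℝ φ y (∫ z in Nᶜ, k z • compensator σ z)) ≤
      A * d ^ (α - σ) * (2 * C₃ * α) := by
    have h1 := hcomp k hk (d / 2) hd2 (by linarith)
    set w := ∫ z in Nᶜ, k z • compensator σ z
    rw [hgrad', ← mul_neg]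
    have h2 : -inner ℝ ν w ≤ ‖w‖ := by
      rw [← inner_neg_left]
      refine (real_inner_le_norm _ _).trans (mul_le_of_le_one_left (norm_nonneg _) ?_)
      rwa [norm_neg]
    have h3 : (d / 2) ^ (1 - σ) ≤ 2 * d ^ (1 - σ) := by
      rw [div_eq_mul_inv, Real.mul_rpow hd.le (by norm_num), mul_comm (2 : ℝ)]
      refine mul_le_mul_of_nonneg_left ?_ (by positivity)
      rw [Real.inv_rpow (by norm_num), ← Real.rpow_neg (by norm_num)]
      exact Real.rpow_le_self_of_one_le (by norm_num) (by linarith)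
    calc A * (α * d ^ (α - 1)) * -inner ℝ ν w
        ≤ A * (α * d ^ (α - 1)) * (C₃ * (2 * d ^ (1 - σ))) :=
          mul_le_mul_of_nonneg_left
            (h2.trans (h1.trans (mul_le_mul_of_nonneg_left h3 hC₃))) (by positivity)
      _ = A * (d ^ (α - 1) * d ^ (1 - σ)) * (2 * C₃ * α) := by ring
      _ = _ := by rw [← Real.rpow_add hd]; ring_nf
  have hfar : ∫ z in Nᶜ, (φ (y + z) - φ y) * k z ≤
      A * d ^ (α - σ) * (12 / σ * (2 * C₂) * α - c₀ / 2) := by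
    have hSm : MeasurableSet S := by
      have : Continuous fun z : E => ‖y + z - p‖ := by fun_prop
      exact (isClosed_le this continuous_const).measurableSet
    -- Since `κ ≤ 1 / 2`, coming within `κ * d` of the ball requires a jump of length at least `d /
    -- 2`.
    have hSN : S ⊆ Nᶜ := by
      intro z hz hzN
      have h1 : ‖y + z - p‖ ≤ r + κ * d := hz
      have h2 := mem_ball_zero_iff.1 hzN
      have h3 := norm_sub_norm_le (y - p) (-z)
      rw [norm_neg, show y - p - -z = y + z - p by abel] at h3
      nlinarith
    have hk0 := hk.integrableOn_compl_ball hσ0 hd2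
    obtain ⟨hi, hle⟩ := hk.moment_compl_ball (by positivity : 0 ≤ σ / 2) (by linarith) hd2
    set c := A * (α * (12 / σ) * d ^ (α - σ / 2)) with hc
    have hc0 : 0 ≤ c := by positivity
    -- On `S` the drop alone suffices and the nonnegative growth term is added for free; off `S`
    -- only growth counts.
    have hpt : ∀ z ∈ Nᶜ, (φ (y + z) - φ y) * k z ≤
        c * (‖z‖ ^ (σ / 2) * k z) - (A * (d ^ α / 2)) * S.indicator k z := by
      intro z hz
      have hz' : d / 2 ≤ ‖z‖ := not_lt.1 fun h => hz (mem_ball_zero_iff.2 h)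
      by_cases hzS : z ∈ S
      · rw [Set.indicator_of_mem hzS, ← mul_assoc, ← sub_mul]
        refine mul_le_mul_of_nonneg_right ?_ (hk.nonneg z)
        have h1 := (htouch z).trans (mul_le_mul_of_nonneg_left
          (ballBarrier_add_sub_le_of_near_ball hα0 hκα hκ0.le hd hy hzS) hA.le)
        have h2 : 0 ≤ c * ‖z‖ ^ (σ / 2) := by positivity
        linarith
      · rw [Set.indicator_of_notMem hzS, mul_zero, sub_zero, ← mul_assoc]
        refine mul_le_mul_of_nonneg_right ?_ (hk.nonneg z)
        refine (htouch z).trans ((mul_le_mul_of_nonneg_left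
          (ballBarrier_add_sub_le_far hσ0 hσ2 hα0 hα hd hy hz') hA.le).trans_eq ?_)
        rw [hc]; ring
    have hik : IntegrableOn (S.indicator k) Nᶜ := hk0.indicator hSm
    have hSint : ∫ z in Nᶜ, S.indicator k z = ∫ z in S, k z := by
      rw [setIntegral_indicator hSm, Set.inter_eq_self_of_subset_right hSN]
    have h3 : (d / 2) ^ (σ / 2 - σ) ≤ 2 * d ^ (σ / 2 - σ) := by
      rw [div_eq_mul_inv, Real.mul_rpow hd.le (by norm_num), mul_comm (2 : ℝ)]
      refine mul_le_mul_of_nonneg_left ?_ (by positivity)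
      rw [Real.inv_rpow (by norm_num), ← Real.rpow_neg (by norm_num)]
      exact Real.rpow_le_self_of_one_le (by norm_num) (by linarith)
    calc ∫ z in Nᶜ, (φ (y + z) - φ y) * k z
        ≤ ∫ z in Nᶜ, (c * (‖z‖ ^ (σ / 2) * k z) - (A * (d ^ α / 2)) * S.indicator k z) :=
          setIntegral_mono_on (hk.integrableOn_sub_mul hσ0 hd2 hφ y)
            ((hi.const_mul c).sub (hik.const_mul _)) measurableSet_ball.compl hpt
      _ = c * (∫ z in Nᶜ, ‖z‖ ^ (σ / 2) * k z) - (A * (d ^ α / 2)) * ∫ z in S, k z := by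
          rw [integral_sub (hi.const_mul c) (hik.const_mul _), integral_const_mul,
            integral_const_mul, hSint]
      _ ≤ c * (C₂ * (2 * d ^ (σ / 2 - σ))) - (A * (d ^ α / 2)) * (c₀ * d ^ (-σ)) :=
          sub_le_sub
            (mul_le_mul_of_nonneg_left (hle.trans (mul_le_mul_of_nonneg_left h3 hC₂0)) hc0)
            (mul_le_mul_of_nonneg_left hmass (by positivity))
      _ = A * ((d ^ (α - σ / 2) * d ^ (σ / 2 - σ)) * (12 / σ * (2 * C₂) * α) -
            (d ^ α * d ^ (-σ)) * (c₀ / 2)) := by rw [hc]; ring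
      _ = _ := by
          rw [← Real.rpow_add hd, ← Real.rpow_add hd]; ring_nf
  have hsplit : ∫ z in Nᶜ, levyIncrement σ φ y z * k z =
      (∫ z in Nᶜ, (φ (y + z) - φ y) * k z) -
        fderiv ℝ φ y (∫ z in Nᶜ, k z • compensator σ z) := by
    have hci := hk.integrableOn_compensator hσ0 hd2
    rw [← ContinuousLinearMap.integral_comp_comm _ hci,
      ← integral_sub (hk.integrableOn_sub_mul hσ0 hd2 hφ y)
        ((fderiv ℝ φ y).integrable_comp hci)]
    refine integral_congr_ae (Filter.Eventually.of_forall fun z => ?_)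
    simp only [levyIncrement_eq, map_smul, smul_eq_mul]
    ring
  have htotal : levyOp σ k φ y = (∫ z in N, levyIncrement σ φ y z * k z) +
      ∫ z in Nᶜ, levyIncrement σ φ y z * k z :=
    (integral_add_compl measurableSet_ball hint).symm
  rw [htotal, hsplit]
  calc _ ≤ A * d ^ (α - σ) * (2 * C₁ * α) +
        (A * d ^ (α - σ) * (12 / σ * (2 * C₂) * α - c₀ / 2) +
          A * d ^ (α - σ) * (2 * C₃ * α)) := by linarith
    _ = _ := by ring

end Barrier

/-! ### Limits of exterior balls and the choice of barrier parameters. -/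

section ExteriorBalls

variable {n : ℕ}

local notation "E" => EuclideanSpace ℝ (Fin n)

/-- The pairs of a boundary point and a centre of an exterior ball of radius `r` touching there,
together with the limits of such pairs. -/
def touchingPairs (Ω : Set E) (ctr : E → ℝ → E) (r : ℝ) : Set (E × E) :=
  closure ((fun x => (x, ctr x r)) '' frontier Ω)

variable {Ω : Set (EuclideanSpace ℝ (Fin n))}
  {ctr : EuclideanSpace ℝ (Fin n) → ℝ → EuclideanSpace ℝ (Fin n)} {rΩ r : ℝ}

theorem IsExteriorBallFamily.norm_sub_center_le (h : IsExteriorBallFamily Ω rΩ ctr) (hr : 0 < r)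
    (hrΩ : r ≤ rΩ) {x : E} (hx : x ∈ frontier Ω) : ‖x - ctr x r‖ ≤ r := by
  have h1 : x ∈ Metric.closedBall (ctr x r) r ∩ closure Ω := by
    rw [h.touches x hx r hr hrΩ]; rfl
  exact mem_closedBall_iff_norm.1 h1.1

theorem IsExteriorBallFamily.lt_norm_sub_center (h : IsExteriorBallFamily Ω rΩ ctr)
    (hΩ : IsOpen Ω) (hr : 0 < r) (hrΩ : r ≤ rΩ) {x y : E} (hx : x ∈ frontier Ω) (hy : y ∈ Ω) :
    r < ‖y - ctr x r‖ := by
  by_contra hle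
  have h1 : y ∈ Metric.closedBall (ctr x r) r ∩ closure Ω :=
    ⟨mem_closedBall_iff_norm.2 (not_lt.1 hle), subset_closure hy⟩
  rw [h.touches x hx r hr hrΩ] at h1
  rw [← Set.mem_singleton_iff.1 h1, hΩ.frontier_eq] at hx
  exact hx.2 hy

theorem fst_mem_frontier_of_mem_touchingPairs {q : E × E} (hq : q ∈ touchingPairs Ω ctr r) :
    q.1 ∈ frontier Ω := by
  have hcl : IsClosed {q : E × E | q.1 ∈ frontier Ω} := isClosed_frontier.preimage continuous_fst
  exact closure_minimal (by rintro _ ⟨x, hx, rfl⟩; exact hx) hcl hq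

theorem IsExteriorBallFamily.norm_sub_le_of_mem_touchingPairs
    (h : IsExteriorBallFamily Ω rΩ ctr) (hr : 0 < r) (hrΩ : r ≤ rΩ) {q : E × E}
    (hq : q ∈ touchingPairs Ω ctr r) : ‖q.1 - q.2‖ ≤ r := by
  have hcl : IsClosed {q : E × E | ‖q.1 - q.2‖ ≤ r} :=
    isClosed_le (by fun_prop) continuous_const
  exact closure_minimal (by rintro _ ⟨x, hx, rfl⟩; exact h.norm_sub_center_le hr hrΩ hx) hcl hq

theorem IsExteriorBallFamily.le_norm_sub_of_mem_touchingPairs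
    (h : IsExteriorBallFamily Ω rΩ ctr) (hΩ : IsOpen Ω) (hr : 0 < r) (hrΩ : r ≤ rΩ) {q : E × E}
    (hq : q ∈ touchingPairs Ω ctr r) {y : E} (hy : y ∈ Ω) : r ≤ ‖y - q.2‖ := by
  have hcl : IsClosed {q : E × E | r ≤ ‖y - q.2‖} :=
    isClosed_le continuous_const (by fun_prop)
  exact closure_minimal
    (by rintro _ ⟨x, hx, rfl⟩; exact (h.lt_norm_sub_center hΩ hr hrΩ hx hy).le) hcl hq

/-- Limits of touching pairs only retain the weak inequality; openness of `Ω` restores a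
quantitative gap, since the two balls are disjoint. -/
theorem IsExteriorBallFamily.add_le_norm_sub_of_ball_subset
    (h : IsExteriorBallFamily Ω rΩ ctr) (hΩ : IsOpen Ω) (hr : 0 < r) (hrΩ : r ≤ rΩ) {q : E × E}
    (hq : q ∈ touchingPairs Ω ctr r) {y : E} {η : ℝ} (hη : 0 < η) (hy : Metric.ball y η ⊆ Ω) :
    r + η ≤ ‖y - q.2‖ := by
  have hdis : Disjoint (Metric.ball q.2 r) (Metric.ball y η) := by
    rw [Set.disjoint_left]
    intro w hw hw'
    have := h.le_norm_sub_of_mem_touchingPairs hΩ hr hrΩ hq (hy hw')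
    exact absurd (mem_ball_iff_norm.1 hw) (not_lt.2 this)
  have := (disjoint_ball_ball_iff hr hη).1 hdis
  rwa [dist_comm, dist_eq_norm] at this

theorem IsExteriorBallFamily.isCompact_touchingPairs
    (h : IsExteriorBallFamily Ω rΩ ctr) (hΩb : Bornology.IsBounded Ω) (hr : 0 < r)
    (hrΩ : r ≤ rΩ) : IsCompact (touchingPairs Ω ctr r) := by
  refine Metric.isCompact_of_isClosed_isBounded isClosed_closure ?_
  have hfb : Bornology.IsBounded (frontier Ω) := hΩb.closure.subset frontier_subset_closure
  refine (hfb.prod (hfb.cthickening (δ := r))).closure.subset (closure_mono ?_)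
  rintro _ ⟨x, hx, rfl⟩
  refine ⟨hx, Metric.mem_cthickening_of_dist_le _ x _ _ hx ?_⟩
  rw [dist_comm, dist_eq_norm]
  exact h.norm_sub_center_le hr hrΩ hx

theorem frontier_nonempty_of_isBounded (hn : 1 ≤ n) (hΩb : Bornology.IsBounded Ω)
    (hne : Ω.Nonempty) : (frontier Ω).Nonempty := by
  have : Nonempty (Fin n) := ⟨⟨0, hn⟩⟩
  rw [Set.nonempty_iff_ne_empty]
  intro h
  rcases frontier_eq_empty_iff.1 h with h | h
  · exact hne.ne_empty h
  · rw [h] at hΩb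
    exact NormedSpace.unbounded_univ ℝ E hΩb

/-- With `d = ‖y - p‖ - r`, a jump in `A` satisfies `‖y + z - p‖ ^ 2 ≤ (r + d) ^ 2 - 2 * d * (r + d)
+ C ^ 2 * d ^ 2 ≤ (r + C ^ 2 * d ^ 2 / (2 * r)) ^ 2`, so it lands in `T`. The volume of order `d ^
n` times the kernel bound gives `d ^ (-σ)`. -/
theorem NondegenerateTowards.le_setIntegral {σ C lam μ : ℝ} {k : E → ℝ} {p y : E}
    (h : NondegenerateTowards σ C lam μ k p r y) (hk : ∀ z, 0 ≤ k z) (hσ2 : σ < 2) (hr : 0 < r)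
    (hd : r < ‖y - p‖) (hlam : 0 < lam) (hμ : 0 < μ) {T : Set E}
    (hT : ∀ z, ‖y + z - p‖ ≤ r + C ^ 2 * (‖y - p‖ - r) ^ 2 / (2 * r) → z ∈ T)
    (hkT : IntegrableOn k T) :
    (2 - σ) * lam * μ * volume.real (Metric.ball (0 : E) 1) * (‖y - p‖ - r) ^ (-σ) ≤
      ∫ z in T, k z := by
  obtain ⟨A, hA, hsub, hvol, hlow⟩ := h
  set d := ‖y - p‖ - r with hddef
  have hd0 : 0 < d := by linarith
  have hAT : A ⊆ T := by
    intro z hz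
    refine hT z ?_
    have h1 : inner ℝ z (‖y - p‖⁻¹ • (y - p)) < -d := (hsub hz).1
    have h2 : ‖z‖ < C * d := mem_ball_zero_iff.1 (hsub hz).2.1
    have hv : 0 < ‖y - p‖ := by linarith
    rw [real_inner_smul_right, real_inner_comm, inv_mul_lt_iff₀ hv] at h1
    have h3 := norm_add_sq_real (y - p) z
    rw [show y - p + z = y + z - p by abel] at h3
    have h4 : ‖z‖ ^ 2 ≤ C ^ 2 * d ^ 2 := by
      rw [← mul_pow]; exact pow_le_pow_left₀ (norm_nonneg _) h2.le 2
    have h5 : ‖y - p‖ = r + d := by rw [hddef]; ring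
    rw [h5] at h1 h3
    have h6 : C ^ 2 * d ^ 2 / (2 * r) * (2 * r) = C ^ 2 * d ^ 2 := by field_simp
    have h7 : 0 ≤ C ^ 2 * d ^ 2 / (2 * r) := by positivity
    refine le_of_sq_le_sq ?_ (by positivity)
    nlinarith [sq_nonneg (C ^ 2 * d ^ 2 / (2 * r)), sq_nonneg d]
  have hAfin : volume A ≠ ⊤ :=
    ((measure_mono fun z hz => (hsub hz).2.1).trans_lt measure_ball_lt_top).ne
  have hball : volume.real (Metric.ball (0 : E) d) =
      d ^ n * volume.real (Metric.ball (0 : E) 1) := by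
    rw [measureReal_def, Measure.addHaar_ball_of_pos _ _ hd0, ENNReal.toReal_mul,
      ENNReal.toReal_ofReal (by positivity), finrank_euclideanSpace_fin, measureReal_def]
  have hvol' : μ * (d ^ n * volume.real (Metric.ball (0 : E) 1)) ≤ volume.real A := by
    have := ENNReal.toReal_mono hAfin hvol
    rwa [ENNReal.toReal_mul, ENNReal.toReal_ofReal hμ.le, ← measureReal_def, ← measureReal_def,
      hball] at this
  have h2σ : 0 < 2 - σ := by linarith
  calc (2 - σ) * lam * μ * volume.real (Metric.ball (0 : E) 1) * d ^ (-σ)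
      = (2 - σ) * lam * d ^ (-(n : ℝ) - σ) *
          (μ * (d ^ n * volume.real (Metric.ball (0 : E) 1))) := by
        rw [← Real.rpow_natCast d n, show -σ = (-(n : ℝ) - σ) + n by ring,
          Real.rpow_add hd0 (-(n : ℝ) - σ)]
        ring_nf
    _ ≤ (2 - σ) * lam * d ^ (-(n : ℝ) - σ) * volume.real A :=
        mul_le_mul_of_nonneg_left hvol' (by positivity)
    _ = ∫ _ in A, (2 - σ) * lam * d ^ (-(n : ℝ) - σ) := by
        rw [setIntegral_const, smul_eq_mul, mul_comm]
    _ ≤ ∫ z in A, k z :=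
        setIntegral_mono_on (integrableOn_const hAfin) (hkT.mono_set hAT) hA hlow
    _ ≤ ∫ z in T, k z :=
        setIntegral_mono_set hkT (Filter.Eventually.of_forall hk)
          (Filter.Eventually.of_forall hAT)

/-- The mass of the jumps landing almost in the exterior ball is bounded below also for limits of
exterior balls. -/
theorem IsExteriorBallFamily.le_setIntegral_of_mem_touchingPairs
    (h : IsExteriorBallFamily Ω rΩ ctr) (hΩ : IsOpen Ω) {σ Λ C lam μ κ : ℝ} {k : E → ℝ}
    (hk : IsLevyKernel σ Λ k) (hσ0 : 0 < σ) (hσ2 : σ < 2) (hr : 0 < r) (hrΩ : r ≤ rΩ)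
    (hC : 0 < C) (hlam : 0 < lam) (hμ : 0 < μ) {y : E} (hy : y ∈ Ω)
    (hnd : ∀ x ∈ frontier Ω, y ∈ Metric.ball (ctr x r) (2 * r) →
      NondegenerateTowards σ C lam μ k (ctr x r) r y)
    (hκ0 : 0 < κ) (hκ : κ ≤ 1 / 2) {q : E × E} (hq : q ∈ touchingPairs Ω ctr r) {d : ℝ}
    (hd : 0 < d) (hdy : ‖y - q.2‖ = r + d) (hdr : d ≤ 1 / 4 * r)
    (hdκ : d ≤ κ / (4 * C ^ 2) * r) :
    (2 - σ) * lam * μ * volume.real (Metric.ball (0 : E) 1) / 4 * d ^ (-σ) ≤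
      ∫ z in {z | ‖y + z - q.2‖ ≤ r + κ * d}, k z := by
  -- A genuine pair replaces the limit pair. Half of `κ * d` pays for moving the centre, the other
  -- half for the curvature error `hkey`.
  obtain ⟨_, ⟨x, hx, rfl⟩, hdist⟩ :=
    Metric.mem_closure_iff.1 hq (κ * d / 2) (by positivity)
  have hpp : ‖q.2 - ctr x r‖ < κ * d / 2 := by
    rw [← dist_eq_norm]
    exact (le_max_right _ _).trans_lt hdist
  set p' := ctr x r
  have hκd : κ * d ≤ d / 2 := by nlinarith
  have hup : ‖y - p'‖ ≤ ‖y - q.2‖ + ‖q.2 - p'‖ := norm_sub_le_norm_sub_add_norm_sub _ _ _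
  have hlt : r < ‖y - p'‖ := h.lt_norm_sub_center hΩ hr hrΩ hx hy
  have hd'2 : ‖y - p'‖ - r ≤ 2 * d := by linarith
  have hd'0 : 0 < ‖y - p'‖ - r := by linarith
  have hkey : C ^ 2 * (‖y - p'‖ - r) ^ 2 / (2 * r) ≤ κ * d / 2 := by
    rw [div_le_iff₀ (by positivity)]
    have h1 : (‖y - p'‖ - r) ^ 2 ≤ (2 * d) ^ 2 := pow_le_pow_left₀ hd'0.le hd'2 2
    have h2 : 4 * C ^ 2 * d ≤ κ * r := by
      have := mul_le_mul_of_nonneg_left hdκ (by positivity : 0 ≤ 4 * C ^ 2)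
      refine this.trans_eq ?_
      field_simp
    calc C ^ 2 * (‖y - p'‖ - r) ^ 2 ≤ C ^ 2 * (2 * d) ^ 2 :=
          mul_le_mul_of_nonneg_left h1 (by positivity)
      _ = (4 * C ^ 2 * d) * d := by ring
      _ ≤ κ * r * d := mul_le_mul_of_nonneg_right h2 hd.le
      _ = κ * d / 2 * (2 * r) := by ring
  have hTsub : {z : E | ‖y + z - q.2‖ ≤ r + κ * d} ⊆ (Metric.ball 0 (d / 2))ᶜ := by
    intro z hz hzN
    have h1 : ‖y + z - q.2‖ ≤ r + κ * d := hz
    have h2 := mem_ball_zero_iff.1 hzN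
    have h3 := norm_sub_norm_le (y - q.2) (-z)
    rw [norm_neg, show y - q.2 - -z = y + z - q.2 by abel] at h3
    linarith
  have hmain := (hnd x hx (mem_ball_iff_norm.2 (by linarith))).le_setIntegral hk.nonneg hσ2 hr hlt
    hlam hμ (T := {z : E | ‖y + z - q.2‖ ≤ r + κ * d}) (fun z hz => by
      have h1 : ‖y + z - q.2‖ ≤ ‖y + z - p'‖ + ‖p' - q.2‖ :=
        norm_sub_le_norm_sub_add_norm_sub _ _ _
      rw [norm_sub_rev p'] at h1
      change ‖y + z - q.2‖ ≤ r + κ * d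
      linarith)
    ((hk.integrableOn_compl_ball hσ0 (by positivity)).mono_set hTsub)
  refine le_trans ?_ hmain
  -- The distance to the genuine ball is at most `2 * d`, which costs the factor `2 ^ (-σ) ≥ 1 / 4`.
  have hpow : d ^ (-σ) / 4 ≤ (‖y - p'‖ - r) ^ (-σ) := by
    have h1 : (2 * d) ^ (-σ) ≤ (‖y - p'‖ - r) ^ (-σ) :=
      Real.rpow_le_rpow_of_nonpos hd'0 hd'2 (by linarith)
    have h2 : (1 / 4 : ℝ) ≤ 2 ^ (-σ) := by
      have : (2 : ℝ) ^ (-2 : ℝ) ≤ 2 ^ (-σ) :=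
        Real.rpow_le_rpow_of_exponent_le (by norm_num) (by linarith)
      refine le_trans (le_of_eq ?_) this
      rw [Real.rpow_neg (by norm_num), Real.rpow_two]; norm_num
    rw [Real.mul_rpow (by norm_num) hd.le] at h1
    nlinarith [Real.rpow_pos_of_pos hd (-σ)]
  have h2σ : 0 < 2 - σ := by linarith
  have hω : 0 ≤ (2 - σ) * lam * μ * volume.real (Metric.ball (0 : E) 1) := by positivity
  calc _ = (2 - σ) * lam * μ * volume.real (Metric.ball (0 : E) 1) * (d ^ (-σ) / 4) := by ring
    _ ≤ _ := mul_le_mul_of_nonneg_left hpow hω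

/-- Multiples of a small power of the distance to a small exterior ball are strict supersolutions,
in the viscosity sense and for all linear operators of the family, close to that ball. -/
theorem exists_strict_barrier_parameters {𝒜 ℬ : Type*} (hn : 1 ≤ n) (hΩ : IsOpen Ω)
    (h : IsExteriorBallFamily Ω rΩ ctr) {σ Λ : ℝ} (hσ0 : 0 < σ) (hσ2 : σ < 2) (hΛ : 0 < Λ)
    (D : IsaacsData n 𝒜 ℬ) (hdrift : σ < 1 → ∀ (a : 𝒜) (b : ℬ), ∀ x ∈ Ω, D.drift a b x = 0)
    {Mb : ℝ} (hMb : ∀ (a : 𝒜) (b : ℬ), ∀ x ∈ Ω, ‖D.drift a b x‖ ≤ Mb) (hMb0 : 0 ≤ Mb)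
    (hK : ∀ (a : 𝒜) (b : ℬ), ∀ x ∈ Ω, IsLevyKernel σ Λ (D.K a b x))
    (hnd : BoundaryNondegenerate σ Ω rΩ ctr D.K) :
    ∃ α ε c₁ r₁ : ℝ, 0 < α ∧ 0 < ε ∧ ε ≤ 1 / 4 ∧ 0 < c₁ ∧ 0 < r₁ ∧ r₁ ≤ rΩ ∧
      ∀ r, 0 < r → r < r₁ → ∀ q ∈ touchingPairs Ω ctr r, ∀ y ∈ Ω, r < ‖y - q.2‖ →
        ‖y - q.2‖ - r ≤ ε * r → ∀ A, 0 < A → ∀ φ, IsTestFunction φ →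
        (∀ z, φ (y + z) - φ y ≤ A * (ballBarrier α r q.2 (y + z) - ballBarrier α r q.2 y)) →
        ∀ a b, A * c₁ ≤ -levyOp σ (D.K a b y) φ y + fderiv ℝ φ y (D.drift a b y) := by
  obtain ⟨C, hC, hmain⟩ := exists_levyOp_le_of_touching_ballBarrier hn hσ0 hσ2 hΛ
  obtain ⟨C₄, r₁, lam, μ, hC₄, hr₁, hr₁Ω, hlam, hμ, hnd⟩ := hnd
  have h2σ : 0 < 2 - σ := by linarith
  have hω : 0 < volume.real (Metric.ball (0 : E) 1) :=
    ENNReal.toReal_pos (Metric.measure_ball_pos volume _ one_pos).ne' measure_ball_lt_top.ne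
  set c₀ := (2 - σ) * lam * μ * volume.real (Metric.ball (0 : E) 1) / 4 with hc₀
  have hc₀0 : 0 < c₀ := by positivity
  -- Operator and drift errors together use at most half of the gain `c₀ / 2`, leaving `c₀ / 4`.
  set α := min (σ / 4) (c₀ / (4 * (C + Mb + 1))) with hα
  have hα0 : 0 < α := lt_min (by positivity) (by positivity)
  have hα4 : α ≤ σ / 4 := min_le_left _ _
  have hαC : (C + Mb) * α ≤ c₀ / 4 := by
    have h1 : α ≤ c₀ / (4 * (C + Mb + 1)) := min_le_right _ _
    rw [le_div_iff₀ (by positivity)] at h1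
    nlinarith
  set κ : ℝ := (1 / 2) ^ (1 / α) with hκ
  have hκ0 : 0 < κ := by positivity
  have hκα : κ ^ α ≤ 1 / 2 := by
    rw [hκ, ← Real.rpow_mul (by norm_num), one_div_mul_cancel hα0.ne', Real.rpow_one]
  have hκ2 : κ ≤ 1 / 2 := by
    have h1 : (1 : ℝ) ≤ 1 / α := by rw [le_div_iff₀ hα0]; linarith
    have := Real.rpow_le_rpow_of_exponent_ge (by norm_num : (0 : ℝ) < 1 / 2) (by norm_num) h1
    rwa [Real.rpow_one] at this
  refine ⟨α, min (1 / 4) (κ / (4 * C₄ ^ 2)), c₀ / 4, min r₁ 1, hα0,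
    lt_min (by norm_num) (by positivity), min_le_left _ _, by positivity,
    lt_min hr₁ one_pos, (min_le_left _ _).trans hr₁Ω.le, ?_⟩
  intro r hr hrr q hq y hy hyq hyε A hA φ hφ htouch a b
  have hrr₁ : r < r₁ := hrr.trans_le (min_le_left _ _)
  have hr1 : r < 1 := hrr.trans_le (min_le_right _ _)
  set d := ‖y - q.2‖ - r with hd
  have hd0 : 0 < d := by linarith
  have hyd : ‖y - q.2‖ = r + d := by rw [hd]; ring
  have hd4 : d ≤ 1 / 4 * r := hyε.trans (mul_le_mul_of_nonneg_right (min_le_left _ _) hr.le)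
  have hdκ : d ≤ κ / (4 * C₄ ^ 2) * r :=
    hyε.trans (mul_le_mul_of_nonneg_right (min_le_right _ _) hr.le)
  have hd1 : d ≤ 1 := by linarith
  have hmass := h.le_setIntegral_of_mem_touchingPairs hΩ (hK a b y hy) hσ0 hσ2 hr
    (hrr₁.trans hr₁Ω).le hC₄ hlam hμ hy (fun x hx hyx => hnd x hx r hr hrr₁ y ⟨hy, hyx⟩ a b)
    hκ0 hκ2 hq hd0 hyd hd4 hdκ
  obtain ⟨h1, h2⟩ := hmain _ (hK a b y hy) q.2 y r d A α κ c₀ hr.le hd0 hd1 hyd hA hα0 hα4 hκ0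
    hκ2 hκα hmass φ hφ htouch
  set t := d ^ (α - σ) with ht
  -- As `α < σ` and `d ≤ 1`, the singular factor is at least one, so the final bound is uniform in
  -- `d`.
  have ht1 : 1 ≤ t := Real.one_le_rpow_of_pos_of_le_one_of_nonpos hd0 hd1 (by linarith)
  have hAt : 0 < A * t := by positivity
  have hdr : -(A * t * (α * Mb)) ≤ fderiv ℝ φ y (D.drift a b y) := by
    rcases lt_or_ge σ 1 with hσ1 | hσ1
    · rw [hdrift hσ1 a b y hy, map_zero]
      have : 0 ≤ A * t * (α * Mb) := by positivity
      linarith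
    · rw [h2]
      set w := ‖y - q.2‖⁻¹ • (y - q.2) with hw
      have hw1 : ‖w‖ ≤ 1 := by
        rw [hw, norm_smul, norm_inv, norm_norm]
        exact inv_mul_le_one
      have h3 : |inner ℝ w (D.drift a b y)| ≤ Mb := by
        refine (abs_real_inner_le_norm _ _).trans ?_
        exact (mul_le_of_le_one_left (norm_nonneg _) hw1).trans (hMb a b y hy)
      have h4 : d ^ (α - 1) ≤ t :=
        Real.rpow_le_rpow_of_exponent_ge hd0 hd1 (by linarith)
      have h5 : A * (α * d ^ (α - 1)) * Mb ≤ A * (α * t) * Mb := by gcongr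
      have h6 : A * (α * d ^ (α - 1)) * -Mb ≤
          A * (α * d ^ (α - 1)) * inner ℝ w (D.drift a b y) :=
        mul_le_mul_of_nonneg_left (neg_le_of_abs_le h3) (by positivity)
      linarith
  have h7 : A * t * ((C + Mb) * α) ≤ A * t * (c₀ / 4) := mul_le_mul_of_nonneg_left hαC hAt.le
  have h8 : A * (c₀ / 4) ≤ A * t * (c₀ / 4) :=
    mul_le_mul_of_nonneg_right (le_mul_of_one_le_right hA.le ht1) (by positivity)
  linarith

end ExteriorBalls

/-! ### The envelope of the barriers. -/

section Envelope

variable {n : ℕ}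

local notation "E" => EuclideanSpace ℝ (Fin n)

theorem continuous_ballBarrier {α : ℝ} (hα : 0 ≤ α) (r : ℝ) :
    Continuous fun x : E × E => ballBarrier α r x.1 x.2 := by
  unfold ballBarrier
  exact (by fun_prop : Continuous fun x : E × E => max (‖x.2 - x.1‖ - r) 0).rpow_const
    fun _ => Or.inr hα

theorem le_ballBarrier {α s r : ℝ} (hα : 0 ≤ α) (hs : 0 ≤ s) {p y : E} (h : s ≤ ‖y - p‖ - r) :
    s ^ α ≤ ballBarrier α r p y :=
  Real.rpow_le_rpow hs (h.trans (le_max_left _ _)) hα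

/-- A multiple of a barrier together with a constant close to the boundary datum lies above a given
bounded continuous function, and above its bound away from the touching ball. -/
theorem IsExteriorBallFamily.exists_radius_factor {Ω : Set (EuclideanSpace ℝ (Fin n))}
    {ctr : EuclideanSpace ℝ (Fin n) → ℝ → EuclideanSpace ℝ (Fin n)} {rΩ : ℝ}
    (h : IsExteriorBallFamily Ω rΩ ctr) (hΩb : Bornology.IsBounded Ω) {g : E → ℝ}
    (hg : Continuous g) {M : ℝ} (hM : ∀ x, |g x| ≤ M) {α ε r₁ : ℝ} (hα : 0 < α) (hε : 0 < ε)
    (hε4 : ε ≤ 1 / 4) (hr₁ : 0 < r₁) (hr₁Ω : r₁ ≤ rΩ) (A₀ : ℝ) {δ : ℝ} (hδ : 0 < δ) :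
    ∃ r A : ℝ, 0 < r ∧ r < r₁ ∧ r ≤ δ ∧ A₀ ≤ A ∧ 0 < A ∧ ∀ q ∈ touchingPairs Ω ctr r, ∀ z,
      g z ≤ g q.1 + δ + A * ballBarrier α r q.2 z ∧
      (ε * r ≤ ‖z - q.2‖ - r → M ≤ g q.1 + δ + A * ballBarrier α r q.2 z) := by
  have hfc : IsCompact (frontier Ω) :=
    Metric.isCompact_of_isClosed_isBounded isClosed_frontier
      (hΩb.closure.subset frontier_subset_closure)
  have hu := hfc.uniformContinuousAt_of_continuousAt g (fun x _ => hg.continuousAt)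
    (Metric.dist_mem_uniformity hδ)
  obtain ⟨η, hη, hηu⟩ := Metric.mem_uniformity_dist.1 hu
  -- With `r ≤ η / 4`, points at distance at least `η` from `q.1` lie outside the collar of width `ε
  -- * r`. The second entry of `A` below lifts the barrier term to at least `2 * M + 1` there.
  set r := min (min (r₁ / 2) δ) (η / 4) with hr
  have hr0 : 0 < r := lt_min (lt_min (by positivity) hδ) (by positivity)
  have hrr₁ : r ≤ r₁ / 2 := (min_le_left _ _).trans (min_le_left _ _)
  have hrη : r ≤ η / 4 := min_le_right _ _
  have hM0 : 0 ≤ M := (abs_nonneg _).trans (hM 0)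
  have hs : 0 < ε * r := by positivity
  have hsα : 0 < (ε * r) ^ α := by positivity
  have hA0 : 0 < max A₀ ((2 * M + 1) / (ε * r) ^ α) := lt_max_of_lt_right (by positivity)
  refine ⟨r, max A₀ ((2 * M + 1) / (ε * r) ^ α), hr0, by linarith,
    (min_le_left _ _).trans (min_le_right _ _), le_max_left _ _, hA0, ?_⟩
  set A := max A₀ ((2 * M + 1) / (ε * r) ^ α) with hA
  intro q hq z
  have hfar : ε * r ≤ ‖z - q.2‖ - r → M ≤ g q.1 + δ + A * ballBarrier α r q.2 z := by
    intro hz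
    have h1 := le_ballBarrier hα.le hs.le hz
    have h2 : 2 * M + 1 ≤ A * ballBarrier α r q.2 z := by
      calc 2 * M + 1 = (2 * M + 1) / (ε * r) ^ α * (ε * r) ^ α := by field_simp
        _ ≤ A * ballBarrier α r q.2 z :=
            mul_le_mul (le_max_right _ _) h1 hsα.le hA0.le
    linarith [neg_le_of_abs_le (hM q.1)]
  refine ⟨?_, hfar⟩
  by_cases hz : dist q.1 z < η
  · have h1 : q.1 ∈ frontier Ω := fst_mem_frontier_of_mem_touchingPairs hq
    have h2 : dist (g q.1) (g z) < δ := hηu hz h1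
    rw [Real.dist_eq] at h2
    have := mul_nonneg hA0.le (ballBarrier_nonneg α r q.2 z)
    linarith [neg_lt_of_abs_lt h2]
  · refine (le_of_abs_le (hM z)).trans (hfar ?_)
    have h1 := h.norm_sub_le_of_mem_touchingPairs hr0 (by linarith) hq
    rw [not_lt, dist_eq_norm] at hz
    have h2 : ‖q.1 - z‖ ≤ ‖q.1 - q.2‖ + ‖q.2 - z‖ := norm_sub_le_norm_sub_add_norm_sub _ _ _
    rw [norm_sub_rev q.2] at h2
    nlinarith

/-- The running minimum of a constant and the first members of a sequence of functions. -/
def runningMin (M : ℝ) (W : ℕ → E → ℝ) : ℕ → E → ℝ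
  | 0 => fun _ => M
  | k + 1 => fun y => min (runningMin M W k y) (W k y)

theorem runningMin_succ (M : ℝ) (W : ℕ → E → ℝ) (k : ℕ) (y : E) :
    runningMin M W (k + 1) y = min (runningMin M W k y) (W k y) := rfl

theorem continuous_runningMin {M : ℝ} {W : ℕ → E → ℝ} (hW : ∀ k, Continuous (W k)) (k : ℕ) :
    Continuous (runningMin M W k) := by
  induction k with
  | zero => exact continuous_const
  | succ k ih => exact ih.min (hW k)

theorem runningMin_le (M : ℝ) (W : ℕ → E → ℝ) (k : ℕ) (y : E) : runningMin M W k y ≤ M := by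
  induction k with
  | zero => exact le_rfl
  | succ k ih => exact (min_le_left _ _).trans ih

theorem le_runningMin {M a : ℝ} {W : ℕ → E → ℝ} {y : E} (hM : a ≤ M) (hW : ∀ k, a ≤ W k y)
    (k : ℕ) : a ≤ runningMin M W k y := by
  induction k with
  | zero => exact hM
  | succ k ih => exact le_min ih (hW k)

theorem runningMin_eq_or (M : ℝ) (W : ℕ → E → ℝ) (k : ℕ) (y : E) :
    runningMin M W k y = M ∨ ∃ j, runningMin M W k y = W j y := by
  induction k with
  | zero => exact Or.inl rfl
  | succ k ih =>
    rw [runningMin_succ]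
    rcases min_choice (runningMin M W k y) (W k y) with h | h
    · rwa [h]
    · exact Or.inr ⟨k, h⟩

theorem runningMin_eq_of_le {M : ℝ} {W : ℕ → E → ℝ} {y : E} {K k : ℕ} (hKk : K ≤ k)
    (hW : ∀ j, K ≤ j → M ≤ W j y) : runningMin M W k y = runningMin M W K y := by
  induction k, hKk using Nat.le_induction with
  | base => rfl
  | succ k hk ih =>
    rw [runningMin_succ, ih]
    exact min_eq_left ((runningMin_le M W K y).trans (hW k hk))

/-- The lower envelope of the barriers: a continuous extension of the exterior datum which is
touched from above, at each point of `Ω`, by its upper bound or by a steep barrier close to the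
corresponding exterior ball. -/
theorem IsExteriorBallFamily.exists_barrier_envelope (hn : 1 ≤ n)
    {Ω : Set (EuclideanSpace ℝ (Fin n))}
    {ctr : EuclideanSpace ℝ (Fin n) → ℝ → EuclideanSpace ℝ (Fin n)} {rΩ : ℝ}
    (h : IsExteriorBallFamily Ω rΩ ctr) (hΩ : IsOpen Ω) (hΩb : Bornology.IsBounded Ω)
    (hne : Ω.Nonempty) {g : E → ℝ} (hg : Continuous g) {M : ℝ} (hM : ∀ x, |g x| ≤ M)
    {α ε r₁ : ℝ} (hα : 0 < α) (hε : 0 < ε) (hε4 : ε ≤ 1 / 4) (hr₁ : 0 < r₁) (hr₁Ω : r₁ ≤ rΩ)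
    (A₀ : ℝ) :
    ∃ u : E → ℝ, Continuous u ∧ (∀ x, |u x| ≤ M) ∧ (∀ x ∈ Ωᶜ, u x = g x) ∧
      ∀ y ∈ Ω, u y = M ∨ ∃ r A : ℝ, ∃ q ∈ touchingPairs Ω ctr r, 0 < r ∧ r < r₁ ∧ A₀ ≤ A ∧
        0 < A ∧ r < ‖y - q.2‖ ∧ ‖y - q.2‖ - r ≤ ε * r ∧
        ∀ z, u z - u y ≤ A * (ballBarrier α r q.2 z - ballBarrier α r q.2 y) := by
  classical
  have hδ : ∀ k : ℕ, (0 : ℝ) < 1 / (k + 1) := fun k => by positivity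
  choose r A hr0 hr1 hrδ hA₀ hA0 hgW hMW using fun k : ℕ =>
    let ⟨r, A, h1, h2, h3, h4, h5, h6⟩ :=
      h.exists_radius_factor hΩb hg hM hα hε hε4 hr₁ hr₁Ω A₀ (hδ k)
    (⟨r, A, h1, h2, h3, h4, h5, fun q hq z => (h6 q hq z).1, fun q hq z => (h6 q hq z).2⟩ :
      ∃ r A : ℝ, 0 < r ∧ r < r₁ ∧ r ≤ 1 / ((k : ℝ) + 1) ∧ A₀ ≤ A ∧ 0 < A ∧
        (∀ q ∈ touchingPairs Ω ctr r, ∀ z,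
          g z ≤ g q.1 + 1 / ((k : ℝ) + 1) + A * ballBarrier α r q.2 z) ∧
        (∀ q ∈ touchingPairs Ω ctr r, ∀ z, ε * r ≤ ‖z - q.2‖ - r →
          M ≤ g q.1 + 1 / ((k : ℝ) + 1) + A * ballBarrier α r q.2 z))
  have hrΩ : ∀ k, r k ≤ rΩ := fun k => (hr1 k).le.trans hr₁Ω
  set w : ℕ → E → E × E → ℝ :=
    fun k y q => g q.1 + 1 / ((k : ℝ) + 1) + A k * ballBarrier α (r k) q.2 y with hw
  have hwc : ∀ k, Continuous fun x : E × (E × E) => w k x.1 x.2 := by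
    intro k
    have h1 := (continuous_ballBarrier (n := n) hα.le (r k)).comp
      (by fun_prop : Continuous fun x : E × (E × E) => (x.2.2, x.1))
    have h2 := hg.comp (by fun_prop : Continuous fun x : E × (E × E) => x.2.1)
    exact (h2.add continuous_const).add (continuous_const.mul h1)
  obtain ⟨x₀, hx₀⟩ := frontier_nonempty_of_isBounded hn hΩb hne
  have hmem : ∀ k, ∀ x ∈ frontier Ω, (x, ctr x (r k)) ∈ touchingPairs Ω ctr (r k) :=
    fun k x hx => subset_closure ⟨x, hx, rfl⟩
  have hcpt : ∀ k, IsCompact (touchingPairs Ω ctr (r k)) :=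
    fun k => h.isCompact_touchingPairs hΩb (hr0 k) (hrΩ k)
  -- Taking the infimum over the compact closure of pairs gives attainment and continuity, although
  -- the choice of centres need not be continuous.
  set W : ℕ → E → ℝ := fun k y => sInf (w k y '' touchingPairs Ω ctr (r k)) with hW
  have hWc : ∀ k, Continuous (W k) := fun k => (hcpt k).continuous_sInf (hwc k)
  have hWatt : ∀ k y, ∃ q ∈ touchingPairs Ω ctr (r k), W k y = w k y q := by
    intro k y
    obtain ⟨q, hq, hq'⟩ := (hcpt k).exists_sInf_image_eq ⟨_, hmem k x₀ hx₀⟩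
      (f := w k y) ((hwc k).comp (Continuous.prodMk_right y)).continuousOn
    exact ⟨q, hq, hq'⟩
  have hWle : ∀ k y, ∀ q ∈ touchingPairs Ω ctr (r k), W k y ≤ w k y q := by
    intro k y q hq
    exact csInf_le ((hcpt k).image ((hwc k).comp (Continuous.prodMk_right y))).bddBelow
      ⟨q, hq, rfl⟩
  have hgle : ∀ k y, g y ≤ W k y := by
    intro k y
    obtain ⟨q, hq, hq'⟩ := hWatt k y
    rw [hq']
    exact hgW k q hq y
  set V := runningMin M W with hV
  have hgV : ∀ k y, g y ≤ V k y := fun k y =>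
    le_runningMin (le_of_abs_le (hM y)) (fun j => hgle j y) k
  have hVbdd : ∀ y, BddBelow (Set.range fun k => V k y) := fun y =>
    ⟨g y, by rintro _ ⟨k, rfl⟩; exact hgV k y⟩
  set u : E → ℝ := fun y => if y ∈ Ω then ⨅ k, V k y else g y with hu
  have huΩ : ∀ y ∈ Ω, u y = ⨅ k, V k y := fun y hy => if_pos hy
  have huc : ∀ y ∉ Ω, u y = g y := fun y hy => if_neg hy
  have hgu : ∀ y, g y ≤ u y := by
    intro y
    by_cases hy : y ∈ Ω
    · rw [huΩ y hy]; exact le_ciInf fun k => hgV k y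
    · rw [huc y hy]
  have huV : ∀ k y, u y ≤ V k y := by
    intro k y
    by_cases hy : y ∈ Ω
    · rw [huΩ y hy]; exact ciInf_le (hVbdd y) k
    · rw [huc y hy]; exact hgV k y
  have huM : ∀ y, u y ≤ M := fun y => huV 0 y
  have huw : ∀ k y, ∀ q ∈ touchingPairs Ω ctr (r k), u y ≤ w k y q := fun k y q hq =>
    (huV (k + 1) y).trans ((min_le_right _ _).trans (hWle k y q hq))
  -- Away from the boundary, balls of small radius are farther than their collar width, so their
  -- barriers exceed `M` and only finitely many indices matter.
  have hloc : ∀ y ∈ Ω, ∃ K : ℕ, ∃ η > 0, ∀ y' ∈ Metric.ball y η, u y' = V K y' := by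
    intro y hy
    obtain ⟨η, hη, hball⟩ := Metric.isOpen_iff.1 hΩ y hy
    obtain ⟨K, hK⟩ := exists_nat_one_div_lt (by positivity : 0 < η / 2)
    refine ⟨K, η / 2, by positivity, fun y' hy' => ?_⟩
    have hsub : Metric.ball y' (η / 2) ⊆ Ω := by
      refine (Metric.ball_subset_ball' ?_).trans hball
      linarith [Metric.mem_ball.1 hy']
    have hbig : ∀ j, K ≤ j → M ≤ W j y' := by
      intro j hj
      obtain ⟨q, hq, hq'⟩ := hWatt j y'
      rw [hq']
      refine hMW j q hq y' ?_
      have h1 := h.add_le_norm_sub_of_ball_subset hΩ (hr0 j) (hrΩ j) hq (by positivity) hsub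
      have h2 : (1 : ℝ) / (j + 1) ≤ 1 / (K + 1) := Nat.one_div_le_one_div hj
      have h3 := hrδ j
      have h4 := hr0 j
      nlinarith
    rw [huΩ y' (hsub (Metric.mem_ball_self (by positivity)))]
    refine le_antisymm (ciInf_le (hVbdd y') K) (le_ciInf fun k => ?_)
    rcases le_total K k with hk | hk
    · exact (runningMin_eq_of_le hk hbig).ge
    · have hanti : Antitone fun k => V k y' := antitone_nat_of_succ_le fun k => min_le_left _ _
      exact hanti hk
  refine ⟨u, ?_, fun x => abs_le.2 ⟨(neg_le_of_abs_le (hM x)).trans (hgu x), huM x⟩, huc, ?_⟩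
  · rw [continuous_iff_continuousAt]
    intro x
    by_cases hx : x ∈ Ω
    · obtain ⟨K, η, hη, hKη⟩ := hloc x hx
      refine (continuous_runningMin (M := M) hWc K).continuousAt.congr ?_
      filter_upwards [Metric.ball_mem_nhds x hη] with y hy
      exact (hKη y hy).symm
    · by_cases hxf : x ∈ closure Ω
      · have hxfr : x ∈ frontier Ω := by rw [hΩ.frontier_eq]; exact ⟨hxf, hx⟩
        rw [ContinuousAt, huc x hx]
        -- At a boundary point `g ≤ u` gives the lower bound; the barrier touching there, of value
        -- `g x + 1 / (k + 1)` at `x`, gives the upper one.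
        refine tendsto_order.2 ⟨fun a ha => ?_, fun a ha => ?_⟩
        · filter_upwards [hg.continuousAt.eventually (lt_mem_nhds ha)] with y hy
          exact hy.trans_le (hgu y)
        · obtain ⟨k, hk⟩ := exists_nat_one_div_lt (sub_pos.2 ha)
          have hq := hmem k x hxfr
          have hwx : w k x (x, ctr x (r k)) < a := by
            have h1 := h.norm_sub_le_of_mem_touchingPairs (hr0 k) (hrΩ k) hq
            have h2 : ballBarrier α (r k) (ctr x (r k)) x = 0 := by
              unfold ballBarrier
              rw [max_eq_right (sub_nonpos.2 h1), Real.zero_rpow hα.ne']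
            simp only [hw, h2, mul_zero, add_zero]
            linarith
          have hc : Continuous fun y => w k y (x, ctr x (r k)) :=
            (hwc k).comp (Continuous.prodMk_left _)
          filter_upwards [hc.continuousAt.eventually (gt_mem_nhds hwx)] with y hy
          exact (huw k y _ hq).trans_lt hy
      · refine hg.continuousAt.congr ?_
        filter_upwards [isClosed_closure.isOpen_compl.mem_nhds hxf] with y hy
        exact (huc y fun hyΩ => hy (subset_closure hyΩ)).symm
  · intro y hy
    obtain ⟨K, η, hη, hKη⟩ := hloc y hy
    have hyV := hKη y (Metric.mem_ball_self hη)
    rcases runningMin_eq_or M W K y with h1 | ⟨j, h1⟩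
    · exact Or.inl (hyV.trans h1)
    · obtain ⟨q, hq, hq'⟩ := hWatt j y
      have huy : u y = w j y q := hyV.trans (h1.trans hq')
      -- Outside its collar the active barrier is at least `M`, so `u y = M`.
      by_cases hd : ε * r j ≤ ‖y - q.2‖ - r j
      · exact Or.inl (le_antisymm (huM y) (by rw [huy]; exact hMW j q hq y hd))
      · refine Or.inr ⟨r j, A j, q, hq, hr0 j, hr1 j, hA₀ j, hA0 j, ?_, (not_le.1 hd).le,
          fun z => ?_⟩
        · obtain ⟨η', hη', hball⟩ := Metric.isOpen_iff.1 hΩ y hy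
          have := h.add_le_norm_sub_of_ball_subset hΩ (hr0 j) (hrΩ j) hq hη' hball
          linarith
        · have h2 := huw j z q hq
          simp only [hw] at h2 huy
          linarith

end Envelope

/-! ### Reflection and the final construction. -/

theorem levyOp_neg {n : ℕ} (σ : ℝ) (k φ : EuclideanSpace ℝ (Fin n) → ℝ)
    (x : EuclideanSpace ℝ (Fin n)) : levyOp σ k (fun y => -φ y) x = -levyOp σ k φ x := by
  unfold levyOp
  rw [← integral_neg]
  refine integral_congr_ae (Filter.Eventually.of_forall fun z => ?_)
  simp only [levyIncrement_eq, fderiv_fun_neg, neg_apply]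
  ring

theorem IsTestFunction.neg {n : ℕ} {φ : EuclideanSpace ℝ (Fin n) → ℝ} (hφ : IsTestFunction φ) :
    IsTestFunction fun y => -φ y := by
  obtain ⟨h, M, hM⟩ := hφ
  exact ⟨h.neg, M, fun x => by rw [abs_neg]; exact hM x⟩

/-- At a point where a test function touches from below a function attaining its maximum, the
Lévy operator is nonpositive and the gradient vanishes. -/
theorem IsLevyKernel.levyOp_nonpos_of_max {n : ℕ} {σ Λ : ℝ}
    {k φ : EuclideanSpace ℝ (Fin n) → ℝ} {x : EuclideanSpace ℝ (Fin n)}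
    (hk : IsLevyKernel σ Λ k) (hmax : ∀ y, φ y ≤ φ x) :
    fderiv ℝ φ x = 0 ∧ levyOp σ k φ x ≤ 0 := by
  have h0 : fderiv ℝ φ x = 0 := IsLocalMax.fderiv_eq_zero (Filter.Eventually.of_forall hmax)
  refine ⟨h0, integral_nonpos fun z => mul_nonpos_of_nonpos_of_nonneg ?_ (hk.nonneg z)⟩
  rw [levyIncrement_eq, h0]
  simpa using hmax (x + z)

/-- A continuous extension of the exterior datum which is a viscosity supersolution of all the
linear equations of the family. -/
theorem exists_common_supersolution {n : ℕ} (hn : 1 ≤ n) {𝒜 ℬ : Type*}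
    {Ω : Set (EuclideanSpace ℝ (Fin n))} (hΩ : IsOpen Ω) (hne : Ω.Nonempty)
    (hΩb : Bornology.IsBounded Ω) {rΩ : ℝ}
    {ctr : EuclideanSpace ℝ (Fin n) → ℝ → EuclideanSpace ℝ (Fin n)}
    (h : IsExteriorBallFamily Ω rΩ ctr) {σ Λ γ : ℝ} (hσ0 : 0 < σ) (hσ2 : σ < 2) (hΛ : 0 < Λ)
    (hγ : 0 < γ) (D : IsaacsData n 𝒜 ℬ)
    (hdrift : σ < 1 → ∀ (a : 𝒜) (b : ℬ), ∀ x ∈ Ω, D.drift a b x = 0)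
    (hc : ∀ (a : 𝒜) (b : ℬ), ∀ x ∈ Ω, γ ≤ D.c a b x)
    (hMb : ∃ M : ℝ, ∀ (a : 𝒜) (b : ℬ), ∀ x ∈ Ω, ‖D.drift a b x‖ ≤ M)
    (hMc : ∃ M : ℝ, ∀ (a : 𝒜) (b : ℬ), ∀ x ∈ Ω, ‖D.c a b x‖ ≤ M)
    (hMf : ∃ M : ℝ, ∀ (a : 𝒜) (b : ℬ), ∀ x ∈ Ω, ‖D.f a b x‖ ≤ M)
    (hK : ∀ (a : 𝒜) (b : ℬ), ∀ x ∈ Ω, IsLevyKernel σ Λ (D.K a b x))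
    (hnd : BoundaryNondegenerate σ Ω rΩ ctr D.K)
    {g : EuclideanSpace ℝ (Fin n) → ℝ} (hg : Continuous g) (hgb : ∃ M : ℝ, ∀ x, |g x| ≤ M) :
    ∃ u : EuclideanSpace ℝ (Fin n) → ℝ, Continuous u ∧ (∃ M : ℝ, ∀ x, |u x| ≤ M) ∧
      (∀ x ∈ Ωᶜ, u x = g x) ∧
      ∀ φ, IsTestFunction φ → ∀ x ∈ Ω, (∀ y, u x - φ x ≤ u y - φ y) → ∀ a b,
        0 ≤ -levyOp σ (D.K a b x) φ x + fderiv ℝ φ x (D.drift a b x) + D.c a b x * u x +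
          D.f a b x := by
  obtain ⟨Mb, hMb⟩ := hMb
  obtain ⟨Mc, hMc⟩ := hMc
  obtain ⟨Mf, hMf⟩ := hMf
  obtain ⟨Mg, hMg⟩ := hgb
  obtain ⟨α, ε, c₁, r₁, hα, hε, hε4, hc₁, hr₁, hr₁Ω, hbar⟩ :=
    exists_strict_barrier_parameters hn hΩ h hσ0 hσ2 hΛ D hdrift
      (Mb := max Mb 0) (fun a b x hx => (hMb a b x hx).trans (le_max_left _ _))
      (le_max_right _ _) hK hnd
  -- This bounds `g` and makes the zeroth-order term dominate the source wherever `u` equals `M`.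
  set M := max Mg (Mf / γ) with hM
  have hM0 : 0 ≤ M := ((abs_nonneg _).trans (hMg 0)).trans (le_max_left _ _)
  have hMfM : Mf ≤ γ * M := by
    have : Mf / γ ≤ M := le_max_right _ _
    rwa [div_le_iff₀' hγ] at this
  -- The steepness `(Mc * M + Mf) / c₁` makes `A * c₁` dominate `c * u + f`.
  obtain ⟨u, huc, hub, hug, htouch⟩ := h.exists_barrier_envelope hn hΩ hΩb hne hg
    (M := M) (fun x => (hMg x).trans (le_max_left _ _)) hα hε hε4 hr₁ hr₁Ω ((Mc * M + Mf) / c₁)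
  refine ⟨u, huc, ⟨M, hub⟩, hug, fun φ hφ x hx hmin a b => ?_⟩
  have hf : -Mf ≤ D.f a b x := neg_le_of_abs_le (hMf a b x hx)
  rcases htouch x hx with hxM | ⟨r, A, q, hq, hr, hrr₁, hA₀, hA, hrx, hxε, hle⟩
  · obtain ⟨h0, h1⟩ := (hK a b x hx).levyOp_nonpos_of_max (φ := φ) (x := x)
      (fun y => by linarith [hmin y, le_of_abs_le (hub y)])
    rw [h0, hxM, zero_apply]
    have := mul_le_mul_of_nonneg_right (hc a b x hx) hM0
    linarith
  · have h1 := hbar r hr hrr₁ q hq x hx hrx hxε A hA φ hφ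
      (fun z => by linarith [hmin (x + z), hle (x + z)]) a b
    rw [div_le_iff₀ hc₁] at hA₀
    have h2 : |D.c a b x * u x| ≤ Mc * M := by
      rw [abs_mul]
      exact mul_le_mul (hMc a b x hx) (hub x) (abs_nonneg _)
        ((norm_nonneg _).trans (hMc a b x hx))
    linarith [neg_le_of_abs_le h2]

end

theorem theorem5p11 {n : ℕ} (hn : 1 ≤ n) {𝒜 ℬ : Type*} [Nonempty 𝒜] [Nonempty ℬ]
    (Ω : Set (EuclideanSpace ℝ (Fin n))) (hΩ_open : IsOpen Ω) (hΩ_conn : IsConnected Ω)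
    (hΩ_bdd : Bornology.IsBounded Ω)
    (rΩ : ℝ) (ctr : EuclideanSpace ℝ (Fin n) → ℝ → EuclideanSpace ℝ (Fin n))
    (hball : IsExteriorBallFamily Ω rΩ ctr)
    (σ : ℝ) (hσ0 : 0 < σ) (hσ2 : σ < 2) (Λ : ℝ) (hΛ : 0 < Λ) (γ : ℝ) (hγ : 0 < γ)
    (D : IsaacsData n 𝒜 ℬ)
    (hdrift : σ < 1 → ∀ (a : 𝒜) (b : ℬ), ∀ x ∈ Ω, D.drift a b x = 0)
    (hc : ∀ (a : 𝒜) (b : ℬ), ∀ x ∈ Ω, γ ≤ D.c a b x)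
    (hK_unif : ∀ z : EuclideanSpace ℝ (Fin n), z ≠ 0 →
      UniformlyBoundedContinuousOn (fun a b x => D.K a b x z) Ω)
    (hdrift_unif : UniformlyBoundedContinuousOn D.drift Ω)
    (hc_unif : UniformlyBoundedContinuousOn D.c Ω)
    (hf_unif : UniformlyBoundedContinuousOn D.f Ω)
    (hK : ∀ (a : 𝒜) (b : ℬ), ∀ x ∈ Ω, IsLevyKernel σ Λ (D.K a b x))
    (hK_bdry : BoundaryNondegenerate σ Ω rΩ ctr D.K)
    (g : EuclideanSpace ℝ (Fin n) → ℝ) (hg_cont : Continuous g)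
    (hg_bdd : ∃ M : ℝ, ∀ x, |g x| ≤ M) :
    (∃ uSup : EuclideanSpace ℝ (Fin n) → ℝ, Continuous uSup ∧
      IsDirichletSupersolution D σ Ω g uSup ∧ ∀ x ∈ Ωᶜ, uSup x = g x) ∧
    (∃ uSub : EuclideanSpace ℝ (Fin n) → ℝ, Continuous uSub ∧
      IsDirichletSubsolution D σ Ω g uSub ∧ ∀ x ∈ Ωᶜ, uSub x = g x) := by
  constructor
  · obtain ⟨u, huc, hub, hug, hu⟩ := exists_common_supersolution hn hΩ_open hΩ_conn.nonempty
      hΩ_bdd hball hσ0 hσ2 hΛ hγ D hdrift hc hdrift_unif.1 hc_unif.1 hf_unif.1 hK hK_bdry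
      hg_cont hg_bdd
    refine ⟨u, huc, ⟨⟨hub, huc.lowerSemicontinuous, fun φ hφ x hx hmin => ?_⟩,
      fun x hx => (hug x hx).ge⟩, hug⟩
    refine le_iSup_of_le (Classical.arbitrary 𝒜) (le_iInf fun b => ?_)
    exact_mod_cast hu φ hφ x hx hmin _ b
  -- Reflection would exchange sup and inf, but `v` is a supersolution for every single pair of
  -- indices, so `-v` satisfies every linear subsolution inequality.
  · obtain ⟨v, hvc, ⟨M, hvb⟩, hvg, hv⟩ := exists_common_supersolution hn hΩ_open hΩ_conn.nonempty
      hΩ_bdd hball hσ0 hσ2 hΛ hγ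
      { K := D.K, drift := D.drift, c := D.c, f := fun a b x => -D.f a b x }
      hdrift hc hdrift_unif.1 hc_unif.1
      (by obtain ⟨M, hM⟩ := hf_unif.1; exact ⟨M, fun a b x hx => by
            rw [norm_neg]; exact hM a b x hx⟩) hK hK_bdry
      (g := fun x => -g x) hg_cont.neg
      (by obtain ⟨M, hM⟩ := hg_bdd; exact ⟨M, fun x => by rw [abs_neg]; exact hM x⟩)
    have hug : ∀ x ∈ Ωᶜ, -v x = g x := fun x hx => by rw [hvg x hx, neg_neg]
    refine ⟨fun x => -v x, hvc.neg, ⟨⟨⟨M, fun x => by rw [abs_neg]; exact hvb x⟩,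
      hvc.neg.upperSemicontinuous, fun φ hφ x hx hmax => ?_⟩, fun x hx => (hug x hx).le⟩, hug⟩
    refine iSup_le fun a => iInf_le_of_le (Classical.arbitrary ℬ) ?_
    have h1 := hv (fun y => -φ y) hφ.neg x hx (fun y => by linarith [hmax y]) a
      (Classical.arbitrary ℬ)
    rw [levyOp_neg, fderiv_fun_neg, neg_apply] at h1
    rw [← EReal.coe_zero, EReal.coe_le_coe_iff]
    linarith
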